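/- **Local universality.** Let $\gamma(\mathrm dz)=\frac1\pi\,\mathrm d^2z$ on $\mathbb C$. For real $N>0$ let $$P_N(z,x)=N\exp\!\big(N(z\bar x-\tfrac{|z|^2}{2}-\tfrac{|x|^2}{2})\big),\qquad z,x\in\mathbb C,$$ which is the kernel of the orthogonal projection $P_N$ of $L^2(\mathbb C,\gamma)$ onto the Fock–Bargmann space $\mathcal B_N=\{u\in L^2(\mathbb C,\gamma): u(z)=g(z)e^{-N|z|^2/2},\ g \text{ entire}\}$. Let $V:\mathbb C\to\mathbb R$ be continuous, $\mu\in\mathbb R$ and $\delta>0$ be such that $\{V\le\mu+\delta\}$ is compact, $\log(V-\mu)$ is Lipschitz on $\{V\ge\mu+\delta\}$, and $V$ is locally Lipschitz on $\{V<\mu+\delta\}$. Let $H_N=P_NVP_N$, the self-adjoint operator on $\mathcal B_N$ with quadratic form $u\mapsto\int V|u|^2\,\mathrm d\gamma$, and let $\Pi_N=\mathbf 1\{H_N\le\mu\}$ be its spectral projection, with continuous integral kernel $\Pi_N(x,z)$ with respect to $\gamma$. For $\eta\in\mathbb R$ let $$\mathcal D_\eta^-=\{x\in\mathbb C:\ \operatorname{dist}(x,\{V\ge\mu-\eta\})\ge\eta\},$$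 and let $\varepsilon_N=N^{-1/2}$. A simple point process $\mathbf X$ on $\mathbb C$ (a random locally finite subset) is *determinantal with kernel $K$* if for all $k\ge0$ and all measurable $F:\mathbb C^k\to[0,\infty]$ $$\mathbb E\sum_{\substack{(x_1,\dots,x_k)\in\mathbf X^k\\ \text{distinct}}}F(x_1,\dots,x_k)=\int_{\mathbb C^k}F(x_1,\dots,x_k)\,\det[K(x_i,x_j)]_{i,j=1}^k\,\gamma(\mathrm dx_1)\cdots\gamma(\mathrm dx_k),$$ and $\mathbf X(f)=\sum_{x\in\mathbf X}f(x)$ denotes its linear statistics. The $\infty$-Ginibre process is the determinantal process with kernel $P_1$. Then there is a constant $C\ge1$ (not depending on $V,\mu,\delta$) such that the following holds. Let $(\delta_N)_{N\ge1}$ be real numbers, non-increasing in $N\in[1,\infty)$, with $\delta_N\ge C\varepsilon_N\log N$ for all large $N$, and let $x_N\in\mathbb C$ satisfy $x_N\in\mathcal D_{\delta_N}^-$ for all large $N$. For $N\ge1$ let $\mathbf X_N$ be a determinantal point process with kernel $\Pi_N$, and let $\mathbf Y$ be an $\infty$-Ginibre process. Then for every continuous compactly supported $f:\mathbb C\to\mathbb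 R$, with $g_N(z)=f\big((z-x_N)/\varepsilon_N\big)$, $$\mathbf X_N(g_N)\ \longrightarrow\ \mathbf Y(f)\qquad\text{in distribution as } N\to\infty .$$ -/

import Mathlib

open MeasureTheory Filter Topology ComplexConjugate

noncomputable section

namespace BerezinToeplitz

/-- The reference measure `dγ(z) = π⁻¹ d²z` on the complex plane. -/
def gam : Measure ℂ := ENNReal.ofReal (1 / Real.pi) • volume

/-- The Hilbert space `L²(ℂ, γ)`; `inner ℂ u v = ∫ conj u · v dγ`. -/
abbrev L2 : Type := Lp ℂ 2 gam

/-- The kernel `P_N(z, x) = N exp(N (z x̄ - |z|²/2 - |x|²/2))`. -/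
def ginibreKernel (N : ℝ) (z x : ℂ) : ℂ :=
  (N : ℂ) * Complex.exp ((N : ℂ) * (z * conj x - (‖z‖ : ℂ) ^ 2 / 2 - (‖x‖ : ℂ) ^ 2 / 2))

/-- The Fock--Bargmann space `𝓑_N ⊆ L²(ℂ, γ)` of functions `g(z) exp(-N |z|² / 2)`
with `g` entire. -/
def fockSpace (N : ℝ) : Submodule ℂ L2 where
  carrier := {u | ∃ g : ℂ → ℂ, Differentiable ℂ g ∧
    (u : ℂ → ℂ) =ᵐ[gam] fun z => g z * (Real.exp (-N * ‖z‖ ^ 2 / 2) : ℂ)}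
  zero_mem' := by
    refine ⟨fun _ => 0, differentiable_const _, ?_⟩
    filter_upwards [Lp.coeFn_zero ℂ 2 gam] with z hz
    rw [zero_mul]
    exact hz
  add_mem' := by
    rintro u v ⟨g, hg, hu⟩ ⟨h, hh, hv⟩
    refine ⟨fun z => g z + h z, hg.add hh, ?_⟩
    filter_upwards [Lp.coeFn_add u v, hu, hv] with z hz hzu hzv
    rw [hz, Pi.add_apply, hzu, hzv, add_mul]
  smul_mem' := by
    rintro c u ⟨g, hg, hu⟩
    refine ⟨fun z => c * g z, hg.const_mul c, ?_⟩
    filter_upwards [Lp.coeFn_smul c u, hu] with z hz hzu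
    rw [hz, Pi.smul_apply, hzu, smul_eq_mul, mul_assoc]

/-! ### The Berezin--Toeplitz operator `H_N = P_N V P_N` on `𝓑_N`

It is the self-adjoint operator on the Hilbert space `𝓑_N` given by the quadratic form
`u ↦ ∫ V |u|² dγ`, whose domain is `{u ∈ 𝓑_N : ∫ |V| |u|² dγ < ∞}`.  For `u, v ∈ 𝓑_N` and bounded
`V` one has `⟨u, P_N V P_N v⟩ = ∫ V ū v dγ`. -/

/-- The form domain of `H_N`. -/
def formDomain (N : ℝ) (V : ℂ → ℝ) : Set L2 :=
  {u | u ∈ fockSpace N ∧ Integrable (fun z => V z * ‖u z‖ ^ 2) gam}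

/-- The sesquilinear form `⟨u, H_N v⟩ = ∫ V ū v dγ`. -/
def toeplitzForm (V : ℂ → ℝ) (u v : L2) : ℂ :=
  ∫ z, (V z : ℂ) * (conj (u z) * v z) ∂gam

/-- `E` is a closed subspace, contained in the form domain, which reduces `H_N` (the form has no
cross terms between `E` and the part of the form domain orthogonal to `E`), and `H_N ≤ μ` on `E`. -/
structure IsReducingBelow (N : ℝ) (V : ℂ → ℝ) (μ : ℝ) (E : Submodule ℂ L2) : Prop where
  isClosed : IsClosed (E : Set L2)
  mem_domain : ∀ u ∈ E, u ∈ formDomain N V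
  reducing : ∀ u ∈ E, ∀ v ∈ formDomain N V, (∀ w ∈ E, inner ℂ w v = 0) → toeplitzForm V u v = 0
  le : ∀ u ∈ E, (toeplitzForm V u u).re ≤ μ * ‖u‖ ^ 2

/-- The spectral subspace of `H_N` for the interval `(-∞, μ]`, i.e. the range of `𝟏{H_N ≤ μ}`.
For a self-adjoint operator that is bounded below, it is the largest closed reducing subspace on
which the operator is at most `μ`. -/
def spectralSubspace (N : ℝ) (V : ℂ → ℝ) (μ : ℝ) : Submodule ℂ L2 :=
  (sSup {E | IsReducingBelow N V μ E}).topologicalClosure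

instance (N : ℝ) (V : ℂ → ℝ) (μ : ℝ) : CompleteSpace (spectralSubspace N V μ) :=
  inferInstanceAs (CompleteSpace (sSup {E | IsReducingBelow N V μ E}).topologicalClosure)

/-- The projection `Π_N = 𝟏{P_N V P_N ≤ μ}` on `𝓑_N`, extended by `0` to `L²(ℂ, γ)`. -/
def spectralProjection (N : ℝ) (V : ℂ → ℝ) (μ : ℝ) : L2 →L[ℂ] L2 :=
  (spectralSubspace N V μ).starProjection

/-- For `N > 0` the functions `P_N(·, z)` are square integrable. -/
theorem memLp_ginibreKernel {N : ℝ} (hN : 0 < N) (z : ℂ) :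
    MemLp (fun w => ginibreKernel N w z) 2 gam := by
  have hcont : Continuous fun w => ginibreKernel N w z := by
    unfold ginibreKernel
    fun_prop
  refine MemLp.smul_measure ?_ ENNReal.ofReal_ne_top
  rw [memLp_two_iff_integrable_sq_norm hcont.aestronglyMeasurable]
  have h := (GaussianFourier.integrable_cexp_neg_mul_sq_norm_add (V := ℂ) (b := (N : ℂ))
    (by simpa using hN) 0 0).norm
  have h2 : Integrable (fun w : ℂ => N ^ 2 * Real.exp (-N * ‖w - z‖ ^ 2)) := by
    have h3 := (h.const_mul (N ^ 2)).comp_sub_right z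
    refine h3.congr (Eventually.of_forall fun w => ?_)
    simp only [Complex.norm_exp]
    congr 2
    simp [← Complex.ofReal_pow]
  refine h2.congr (Eventually.of_forall fun w => ?_)
  simp only [ginibreKernel, norm_mul, Complex.norm_exp, Complex.norm_real, Real.norm_eq_abs,
    mul_pow, sq_abs]
  rw [← Real.exp_nat_mul]
  congr 2
  simp only [← Complex.ofReal_pow, ← Complex.normSq_eq_norm_sq, Complex.normSq_apply,
    Complex.sub_re, Complex.sub_im, Complex.mul_re, Complex.conj_re,
    Complex.conj_im]
  norm_num [Complex.div_re, Complex.normSq_apply]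
  ring

open Classical in
/-- The function `P_N(·, z)` as an element of `L²(ℂ, γ)` (the value for `N ≤ 0` is irrelevant). -/
def reproducing (N : ℝ) (z : ℂ) : L2 :=
  if h : MemLp (fun w => ginibreKernel N w z) 2 gam then h.toLp _ else 0

/-- The continuous integral kernel `Π_N(x, z)` of `Π_N`.  Since the range of `Π_N` lies in `𝓑_N`,
whose reproducing kernel is `P_N`, one has `Π_N(x, z) = (Π_N P_N(·, z))(x)
= ⟨P_N(·, x), Π_N P_N(·, z)⟩ = ∑ₖ uₖ(x) conj (uₖ(z))` for any orthonormal basis `(uₖ)` of the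
range. -/
def spectralKernel (N : ℝ) (V : ℂ → ℝ) (μ : ℝ) (x z : ℂ) : ℂ :=
  inner ℂ (reproducing N x) (spectralProjection N V μ (reproducing N z))

/-! ### Determinantal point processes -/

/-- A simple point process on `ℂ` defined on `Ω`: a random locally finite set of points. -/
structure PointProcess (Ω : Type*) [MeasurableSpace Ω] where
  /-- the random set of points -/
  points : Ω → Set ℂ
  locallyFinite : ∀ ω (K : Set ℂ), IsCompact K → (points ω ∩ K).Finite
  measurable_count : ∀ B : Set ℂ, MeasurableSet B → Measurable fun ω => (points ω ∩ B).encard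

/-- The linear statistic `𝐗(f) = ∑_{x ∈ 𝐗} f(x)`; a finite sum if `f` has compact support. -/
def PointProcess.linearStatistic {Ω : Type*} [MeasurableSpace Ω] (X : PointProcess Ω)
    (f : ℂ → ℝ) (ω : Ω) : ℝ :=
  ∑' x : X.points ω, f x

/-- `X` is, under the probability `P`, determinantal with correlation kernel `K` with respect to
`γ`: for every `k`, the expectation of the sum of an observable over all `k`-tuples of distinct
points is its integral against the density `det [K(xᵢ, xⱼ)]`.  (For the positive semi-definite
kernels considered here, this determinant is real and nonnegative.) -/
def IsDeterminantal {Ω : Type*} [MeasurableSpace Ω] (P : Measure Ω) (X : PointProcess Ω)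
    (K : ℂ → ℂ → ℂ) : Prop :=
  ∀ (k : ℕ) (F : (Fin k → ℂ) → ENNReal), Measurable F →
    ∫⁻ ω, ∑' p : Fin k ↪ X.points ω, F (fun i => (p i : ℂ)) ∂P =
      ∫⁻ x, F x * ENNReal.ofReal (Matrix.det (Matrix.of fun i j => K (x i) (x j))).re
        ∂(Measure.pi fun _ : Fin k => gam)

/-! ### Potentials and the bulk -/

/-- The assumptions on the potential `V`, the energy `μ` and the margin `δ`: `V` is continuous,
`{V ≤ μ + δ}` is compact, `log (V - μ)` is Lipschitz on `{V ≥ μ + δ}`, and `V` is locally Lipschitz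
on `{V < μ + δ}`. -/
structure PotentialAssumption (V : ℂ → ℝ) (μ δ : ℝ) : Prop where
  pos : 0 < δ
  continuous : Continuous V
  isCompact : IsCompact {z | V z ≤ μ + δ}
  lipschitz_log : ∃ K, LipschitzOnWith K (fun z => Real.log (V z - μ)) {z | μ + δ ≤ V z}
  locallyLipschitz : LocallyLipschitzOn {z | V z < μ + δ} V

/-- The bulk `𝓓⁻_η(μ) = {x : dist(x, {V ≥ μ - η}) ≥ η}`. -/
def bulk (V : ℂ → ℝ) (μ η : ℝ) : Set ℂ :=
  {x | ∀ y, μ - η ≤ V y → η ≤ dist x y}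

/-- The microscopic scale `ε_N = N^{-1/2}`. -/
def microscale (N : ℝ) : ℝ := N ^ (-(1 / 2) : ℝ)

end BerezinToeplitz

end

/-!
Local universality rests on the convergence of the rescaled kernels `N⁻¹ Π_N(x_N + ε_N u, x_N +
ε_N v)` to `P_1(u, v)`, up to a unimodular gauge factor which drops out of determinants, and on
the fact that a determinantal process depends continuously on its kernel.

*Kernels.* The kernel of `P_N` rescales exactly to that of `P_1`, by magnetic translations
(`ginibreKernel_rescaled`), and `P_N - Π_N` is a projection, so by Cauchy--Schwarz only `‖(1 -
Π_N) P_N(·, x)‖² / N` has to be small for `x` near `x_N` (`norm_spectralKernel_sub_le`). The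
coherent state `ψ = N^{-1/2} P_N(·, x)` is a Gaussian of width `ε_N` at `x`, and `V` is Lipschitz
near `{V ≤ μ}` and grows at most exponentially, so `‖(V - V(x)) ψ‖ = O(ε_N)`: `ψ` is a quasimode
of energy `V(x)`. In the bulk `μ - V(x)` is at least of order `C ε_N log N`, and dividing the
error by this spectral distance gives `‖(1 - Π_N) ψ‖ = O(1 / log N)`. Hence `C = 1` is already
sufficient for convergence without a rate.

The spectral subspace is only known as the largest reducing subspace on which `H_N ≤ μ`, so it is
enough to exhibit one reducing subspace close to `ψ`. It is found through the resolvent `T = (H_N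
+ c)⁻¹`. With `M` the multiplication by `(V + c)^{-1/2}` and `p` the projection onto the closed
subspace `M⁻¹(𝓑_N)` one has `T = M p M`, and the subspace is the kernel of the positive part of
`(μ + c)⁻¹ - T` (`exists_spectral_splitting`, `exists_isReducingBelow_quasimode`).

*Processes.* The characteristic function of `𝐗(f)` is the expectation of `∏ (1 + φ(x))` over the
points, with `φ = e^{itf} - 1`. Expanding the product gives the Fredholm series `∑ₖ (1/k!) ∫ ∏
φ(xᵢ) det [K(xᵢ, xⱼ)]` (`IsDeterminantal.charFun_linearStatistic`). The kernels are Gram kernels,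
so the determinants are at most `1` after rescaling, and dominated convergence applies both in
each integral and in the sum (`tendsto_fredholmSeries`). Lévy's theorem then yields convergence in
distribution.
-/

noncomputable section

namespace BerezinToeplitz

/-! ### The Fock--Bargmann space and its reproducing kernel -/

theorem integral_gam {F : Type*} [NormedAddCommGroup F] [NormedSpace ℝ F] (f : ℂ → F) :
    ∫ z, f z ∂gam = (1 / Real.pi) • ∫ z, f z := by
  rw [gam, integral_smul_measure, ENNReal.toReal_ofReal (by positivity)]

theorem integrable_gam_iff {F : Type*} [NormedAddCommGroup F] {f : ℂ → F} :
    Integrable f gam ↔ Integrable f := by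
  rw [gam]
  exact integrable_smul_measure (by simp [Real.pi_pos]) ENNReal.ofReal_ne_top

/-- Mean value property with a radial weight: average the rotation-invariant integral over the
angle of rotation and use the mean value property of `g` on circles. -/
theorem integral_mul_radial {g : ℂ → ℂ} (hg : Differentiable ℂ g) {ρ : ℝ → ℂ} (hρ : Continuous ρ)
    (hint : Integrable fun s : ℂ => g s * ρ ‖s‖) :
    ∫ s : ℂ, g s * ρ ‖s‖ = g 0 * ∫ s : ℂ, ρ ‖s‖ := by
  have hrot : ∀ θ : ℝ, ∫ s : ℂ, g (circleMap 0 1 θ * s) * ρ ‖s‖ = ∫ s : ℂ, g s * ρ ‖s‖ := by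
    intro θ
    have := (rotation (Circle.exp θ)).measurePreserving.integral_comp
      (rotation (Circle.exp θ)).toHomeomorph.measurableEmbedding (fun s : ℂ => g s * ρ ‖s‖)
    rw [← this]
    refine integral_congr_ae (Eventually.of_forall fun s => ?_)
    simp [circleMap, rotation_apply]
  have hrotint : ∀ θ : ℝ, Integrable fun s : ℂ => g (circleMap 0 1 θ * s) * ρ ‖s‖ := by
    intro θ
    have := (rotation (Circle.exp θ)).measurePreserving.integrable_comp_of_integrable hint
    refine this.congr (Eventually.of_forall fun s => ?_)
    simp [circleMap, rotation_apply]
  have hnorm : ∀ θ : ℝ, ∫ s : ℂ, ‖g (circleMap 0 1 θ * s) * ρ ‖s‖‖ = ∫ s : ℂ, ‖g s * ρ ‖s‖‖ := by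
    intro θ
    have := (rotation (Circle.exp θ)).measurePreserving.integral_comp
      (rotation (Circle.exp θ)).toHomeomorph.measurableEmbedding (fun s : ℂ => ‖g s * ρ ‖s‖‖)
    rw [← this]
    refine integral_congr_ae (Eventually.of_forall fun s => ?_)
    simp [circleMap, rotation_apply]
  have hmean : ∀ s : ℂ, ∫ θ in (0:ℝ)..(2 * Real.pi), g (circleMap 0 1 θ * s) * ρ ‖s‖
      = (2 * Real.pi) • (g 0 * ρ ‖s‖) := by
    intro s
    have hd : DiffContOnCl ℂ (fun z => g (z * s)) (Metric.ball 0 |(1:ℝ)|) :=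
      (hg.comp (differentiable_id.mul_const s)).diffContOnCl
    have h := hd.circleAverage
    rw [Real.circleAverage_def, inv_smul_eq_iff₀ (by positivity)] at h
    rw [intervalIntegral.integral_mul_const, h]
    simp [mul_assoc]
  have hprod : Integrable (Function.uncurry fun (θ : ℝ) (s : ℂ) => g (circleMap 0 1 θ * s) * ρ ‖s‖)
      ((volume.restrict (Set.Ioc 0 (2 * Real.pi))).prod volume) := by
    have hc : Continuous (Function.uncurry
        fun (θ : ℝ) (s : ℂ) => g (circleMap 0 1 θ * s) * ρ ‖s‖) := by
      have := hg.continuous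
      unfold Function.uncurry
      fun_prop
    refine (integrable_prod_iff hc.aestronglyMeasurable).2 ⟨?_, ?_⟩
    · exact Eventually.of_forall fun θ => hrotint θ
    · simp only [Function.uncurry_apply_pair, hnorm]
      exact integrable_const _
  have hswap := integral_integral_swap hprod
  simp only [hrot] at hswap
  simp only [← intervalIntegral.integral_of_le Real.two_pi_pos.le, hmean] at hswap
  rw [integral_smul, integral_const_mul, intervalIntegral.integral_const, sub_zero] at hswap
  exact smul_right_injective ℂ (r := (2 * Real.pi)) (by positivity) hswap

theorem integral_gaussian_norm {N : ℝ} (hN : 0 < N) :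
    ∫ s : ℂ, ((Real.exp (-N * ‖s‖ ^ 2) : ℝ) : ℂ) = Real.pi / N := by
  rw [integral_complex_ofReal, GaussianFourier.integral_rexp_neg_mul_sq_norm hN]
  simp

/-- The holomorphic factor of the coherent state `P_N(·, x)`. -/
def coherentFactor (N : ℝ) (x z : ℂ) : ℂ :=
  (N : ℂ) * Complex.exp ((N : ℂ) * (z * conj x - (‖x‖ : ℂ) ^ 2 / 2))

theorem ginibreKernel_eq_coherentFactor_mul (N : ℝ) (z x : ℂ) :
    ginibreKernel N z x = coherentFactor N x z * (Real.exp (-N * ‖z‖ ^ 2 / 2) : ℂ) := by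
  rw [ginibreKernel, coherentFactor, mul_assoc]
  congr 1
  push_cast
  rw [← Complex.exp_add]
  congr 1
  ring

theorem differentiable_coherentFactor (N : ℝ) (x : ℂ) : Differentiable ℂ (coherentFactor N x) := by
  unfold coherentFactor
  fun_prop

theorem coeFn_reproducing {N : ℝ} (hN : 0 < N) (x : ℂ) :
    (reproducing N x : ℂ → ℂ) =ᵐ[gam] fun w => ginibreKernel N w x := by
  rw [reproducing, dif_pos (memLp_ginibreKernel hN x)]
  exact MemLp.coeFn_toLp _

theorem reproducing_mem_fockSpace {N : ℝ} (hN : 0 < N) (x : ℂ) :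
    reproducing N x ∈ fockSpace N := by
  refine ⟨coherentFactor N x, differentiable_coherentFactor N x, ?_⟩
  filter_upwards [coeFn_reproducing hN x] with w hw
  rw [hw, ginibreKernel_eq_coherentFactor_mul]

/-- The reproducing property `⟨P_N(·, x), u⟩ = u(x)` on the Fock--Bargmann space. After centring at
`x`, the integrand is an entire function times `exp(-N |s|²)`. -/
theorem inner_reproducing {N : ℝ} (hN : 0 < N) (x : ℂ) {u : L2} {g : ℂ → ℂ}
    (hg : Differentiable ℂ g)
    (hu : (u : ℂ → ℂ) =ᵐ[gam] fun z => g z * (Real.exp (-N * ‖z‖ ^ 2 / 2) : ℂ)) :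
    inner ℂ (reproducing N x) u = g x * (Real.exp (-N * ‖x‖ ^ 2 / 2) : ℂ) := by
  let F : ℂ → ℂ := fun w => (g w * (Real.exp (-N * ‖w‖ ^ 2 / 2) : ℂ)) * conj (ginibreKernel N w x)
  have hF : (fun w => inner ℂ ((reproducing N x : ℂ → ℂ) w) ((u : ℂ → ℂ) w)) =ᵐ[gam] F := by
    filter_upwards [coeFn_reproducing hN x, hu] with w hw hw'
    rw [hw, hw', RCLike.inner_apply]
  have hFint : Integrable F := by
    rw [← integrable_gam_iff]
    exact (L2.integrable_inner _ _).congr hF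
  let h : ℂ → ℂ := fun s => N * g (s + x) *
    Complex.exp (-(N * (conj x * s))) * (Real.exp (-N * ‖x‖ ^ 2 / 2) : ℂ)
  -- centred at `x`, the integrand is an entire function times a radial Gaussian
  have hFs : ∀ s, F (s + x) = h s * ((Real.exp (-N * ‖s‖ ^ 2) : ℝ) : ℂ) := by
    intro s
    simp only [F, h, ginibreKernel, map_mul, Complex.conj_ofReal, ← Complex.exp_conj,
      Complex.ofReal_exp, map_sub, map_pow, map_div₀, Complex.conj_conj, map_add]
    have e2 : (starRingEnd ℂ) 2 = 2 := map_ofNat _ 2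
    have key : Complex.exp ((-N * ‖s + x‖ ^ 2 / 2 : ℝ) : ℂ) * Complex.exp (↑N *
        (((starRingEnd ℂ) s + (starRingEnd ℂ) x) * x - (‖s + x‖:ℂ) ^ 2 / 2 - (‖x‖:ℂ) ^ 2 / 2)) =
        Complex.exp (-(↑N * ((starRingEnd ℂ) x * s))) * Complex.exp ((-N * ‖x‖ ^ 2 / 2 : ℝ) : ℂ) *
        Complex.exp ((-N * ‖s‖ ^ 2 : ℝ) : ℂ) := by
      simp only [← Complex.exp_add]
      congr 1
      push_cast
      rw [← Complex.conj_mul' (s + x), ← Complex.conj_mul' s, ← Complex.conj_mul' x, map_add]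
      ring
    rw [e2]
    linear_combination (N * g (s + x)) * key
  have hhd : Differentiable ℂ h := by
    have : Differentiable ℂ fun s => g (s + x) := hg.comp (differentiable_id.add_const x)
    fun_prop
  have hmain := integral_mul_radial hhd (ρ := fun r => ((Real.exp (-N * r ^ 2) : ℝ) : ℂ))
    (by fun_prop) (by simpa only [hFs] using hFint.comp_add_right x)
  rw [L2.inner_def, integral_congr_ae hF, integral_gam, ← integral_add_right_eq_self F x]
  simp only [hFs]
  rw [hmain, integral_gaussian_norm hN]
  simp only [h, zero_add, mul_zero, neg_zero, Complex.exp_zero, mul_one]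
  have hN' : (N : ℂ) ≠ 0 := by exact_mod_cast hN.ne'
  have hpi : (Real.pi : ℂ) ≠ 0 := by exact_mod_cast Real.pi_ne_zero
  rw [Complex.real_smul]
  push_cast
  field_simp

theorem inner_reproducing_reproducing {N : ℝ} (hN : 0 < N) (x z : ℂ) :
    inner ℂ (reproducing N x) (reproducing N z) = ginibreKernel N x z := by
  rw [ginibreKernel_eq_coherentFactor_mul]
  refine inner_reproducing hN x (differentiable_coherentFactor N z) ?_
  filter_upwards [coeFn_reproducing hN z] with w hw
  rw [hw, ginibreKernel_eq_coherentFactor_mul]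

theorem ginibreKernel_self (N : ℝ) (x : ℂ) : ginibreKernel N x x = N := by
  rw [ginibreKernel, Complex.mul_conj', show ((‖x‖ : ℂ) ^ 2 - (‖x‖ : ℂ) ^ 2 / 2
    - (‖x‖ : ℂ) ^ 2 / 2) = 0 by ring]
  simp

theorem norm_sq_reproducing {N : ℝ} (hN : 0 < N) (x : ℂ) : ‖reproducing N x‖ ^ 2 = N := by
  have h := inner_reproducing_reproducing hN x x
  rw [ginibreKernel_self, inner_self_eq_norm_sq_to_K] at h
  exact Complex.ofReal_injective (by rw [Complex.ofReal_pow]; exact h)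

theorem norm_reproducing {N : ℝ} (hN : 0 < N) (x : ℂ) : ‖reproducing N x‖ = √N := by
  rw [← Real.sqrt_sq (norm_nonneg (reproducing N x)), norm_sq_reproducing hN]

theorem continuous_reproducing {N : ℝ} (hN : 0 < N) : Continuous (reproducing N) := by
  rw [continuous_iff_continuousAt]
  intro x
  rw [ContinuousAt, tendsto_iff_norm_sub_tendsto_zero]
  have h : ∀ y, ‖reproducing N y - reproducing N x‖ =
      √(2 * N - 2 * (ginibreKernel N y x).re) := by
    intro y
    rw [← Real.sqrt_sq (norm_nonneg (reproducing N y - reproducing N x)),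
      @norm_sub_sq ℂ, norm_sq_reproducing hN, norm_sq_reproducing hN,
      inner_reproducing_reproducing hN]
    congr 1
    change N - 2 * (ginibreKernel N y x).re + N = _
    ring
  have hc : Continuous fun y => √(2 * N - 2 * (ginibreKernel N y x).re) := by
    unfold ginibreKernel
    fun_prop
  have := hc.tendsto x
  simpa only [h, ginibreKernel_self, Complex.ofReal_re, sub_self, Real.sqrt_zero] using this

/-- By the reproducing property, `L²` convergence in the Fock space implies locally uniform
convergence of the holomorphic factors. -/
theorem isClosed_fockSpace {N : ℝ} (hN : 0 < N) : IsClosed (fockSpace N : Set L2) := by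
  refine IsSeqClosed.isClosed fun u v hu huv => ?_
  choose g hg hug using hu
  have hval : ∀ n z, g n z = (Real.exp (N * ‖z‖ ^ 2 / 2) : ℂ) * inner ℂ (reproducing N z) (u n) := by
    intro n z
    rw [inner_reproducing hN z (hg n) (hug n), mul_left_comm, ← Complex.ofReal_mul, ← Real.exp_add]
    simp [neg_div, neg_mul]
  let G : ℂ → ℂ := fun z => (Real.exp (N * ‖z‖ ^ 2 / 2) : ℂ) * inner ℂ (reproducing N z) v
  have hlim : TendstoLocallyUniformlyOn g G atTop Set.univ := by
    rw [tendstoLocallyUniformlyOn_iff_forall_isCompact isOpen_univ]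
    intro K _ hK
    obtain ⟨R, hR⟩ := hK.isBounded.exists_norm_le
    rw [Metric.tendstoUniformlyOn_iff]
    intro ε hε
    have h0 : Tendsto (fun n => Real.exp (N * R ^ 2 / 2) * (√N * ‖v - u n‖)) atTop (𝓝 0) := by
      have h1 : Tendsto (fun n => ‖v - u n‖) atTop (𝓝 0) := by
        have := (tendsto_iff_norm_sub_tendsto_zero.1 huv)
        simpa only [norm_sub_rev] using this
      simpa using ((h1.const_mul (√N)).const_mul (Real.exp (N * R ^ 2 / 2)))
    filter_upwards [h0.eventually (gt_mem_nhds hε)] with n hn z hz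
    refine lt_of_le_of_lt ?_ hn
    rw [dist_eq_norm, hval, ← mul_sub, ← inner_sub_right, norm_mul, Complex.norm_real,
      Real.norm_eq_abs, abs_of_pos (Real.exp_pos _)]
    have hzR := hR z hz
    refine mul_le_mul (Real.exp_le_exp.2 ?_) ?_ (norm_nonneg _) (Real.exp_pos _).le
    · have : ‖z‖ ^ 2 ≤ R ^ 2 := pow_le_pow_left₀ (norm_nonneg _) hzR 2
      nlinarith
    · rw [← norm_reproducing hN z]
      exact norm_inner_le_norm _ _
  have hGd : Differentiable ℂ G := by
    have := hlim.differentiableOn (Eventually.of_forall fun n => (hg n).differentiableOn)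
      isOpen_univ
    exact differentiableOn_univ.1 this
  refine ⟨G, hGd, ?_⟩
  obtain ⟨ns, hns, hae⟩ := (tendstoInMeasure_of_tendsto_Lp huv).exists_seq_tendsto_ae
  have hall : ∀ᵐ z ∂gam, ∀ n, (u n : ℂ → ℂ) z = g n z * (Real.exp (-N * ‖z‖ ^ 2 / 2) : ℂ) :=
    ae_all_iff.2 hug
  filter_upwards [hae, hall] with z hz hz'
  refine tendsto_nhds_unique hz ?_
  simp only [hz']
  have hp := (hlim.tendsto_at (Set.mem_univ z)).comp hns.tendsto_atTop
  exact hp.mul_const _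

/-! ### Spectral splitting of a bounded self-adjoint operator -/

/-- The spectral subspace `E = ran 𝟏{T ≥ τ}`, realised without spectral measures as the kernel of
the positive part of `τ - T`. On `E` the operator `T` is invertible with `T⁻¹ ≤ τ⁻¹`, and on `Eᗮ`
one has `T ≤ τ` since the range of the negative part of `τ - T` lies in `E`. -/
theorem exists_spectral_splitting {H : Type*} [NormedAddCommGroup H] [InnerProductSpace ℂ H]
    [CompleteSpace H] {T : H →L[ℂ] H} (hT : IsSelfAdjoint T) {τ : ℝ} (hτ : 0 < τ) :
    ∃ E : Submodule ℂ H, IsClosed (E : Set H) ∧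
      (∀ u ∈ E, ∃ v ∈ E, T v = u ∧ τ * (inner ℂ u v).re ≤ ‖u‖ ^ 2) ∧
      (∀ u ∈ E, T u ∈ E) ∧
      ∀ q ∈ Eᗮ, (inner ℂ q (T q)).re ≤ τ * ‖q‖ ^ 2 := by
  set A : H →L[ℂ] H := algebraMap ℝ (H →L[ℂ] H) τ - T with hA
  have hAsa : IsSelfAdjoint A := (IsSelfAdjoint.algebraMap _ (IsSelfAdjoint.all τ)).sub hT
  set B : H →L[ℂ] H := A⁺ with hB
  set D : H →L[ℂ] H := A⁻ with hD
  have hBD : B * D = 0 := CFC.posPart_mul_negPart A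
  have hDB : D * B = 0 := CFC.negPart_mul_posPart A
  have hsub : B - D = A := CFC.posPart_sub_negPart A hAsa
  have hBpos : B.IsPositive := (ContinuousLinearMap.nonneg_iff_isPositive B).1 (CFC.posPart_nonneg A)
  have hDnn : 0 ≤ D := CFC.negPart_nonneg A
  have hDpos : D.IsPositive := (ContinuousLinearMap.nonneg_iff_isPositive D).1 hDnn
  have hBDv : ∀ v, B (D v) = 0 := fun v => DFunLike.congr_fun hBD v
  have hDBv : ∀ v, D (B v) = 0 := fun v => DFunLike.congr_fun hDB v
  have hTv : ∀ v, T v = (τ : ℂ) • v - B v + D v := by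
    intro v
    have h1 : T = algebraMap ℝ (H →L[ℂ] H) τ - B + D := by
      rw [sub_add, hsub, hA, sub_sub_cancel]
    rw [h1, Algebra.algebraMap_eq_smul_one]
    simp
  -- on `ker B` the operator `T` agrees with `τ + D`, which is invertible on the whole space
  have hunit : IsUnit (algebraMap ℝ (H →L[ℂ] H) τ + D) := by
    have h1 : -τ ∉ spectrum ℝ D := fun h => by
      have := spectrum_nonneg_of_nonneg hDnn h
      linarith
    rw [spectrum.notMem_iff] at h1
    have h2 := h1.neg
    rwa [map_neg, ← neg_add', neg_neg] at h2
  obtain ⟨S, hS⟩ := hunit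
  set S' : H →L[ℂ] H := ((S⁻¹ : (H →L[ℂ] H)ˣ) : H →L[ℂ] H)
  have hSS' : ∀ v, (τ : ℂ) • S' v + D (S' v) = v := by
    intro v
    have h1 : (algebraMap ℝ (H →L[ℂ] H) τ + D) * S' = 1 := by rw [← hS]; exact S.mul_inv
    have h2 := DFunLike.congr_fun h1 v
    rw [Algebra.algebraMap_eq_smul_one] at h2
    simpa using h2
  refine ⟨LinearMap.ker (B : H →ₗ[ℂ] H), B.isClosed_ker, ?_, ?_, ?_⟩
  · intro u hu
    have hu' : B u = 0 := hu
    have hv : B (S' u) = 0 := by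
      have h1 := congrArg B (hSS' u)
      rw [map_add, map_smul, hBDv, add_zero, hu'] at h1
      exact (smul_eq_zero.1 h1).resolve_left (by exact_mod_cast hτ.ne')
    refine ⟨S' u, hv, ?_, ?_⟩
    · rw [hTv, hv, sub_zero, hSS']
    · set v := S' u
      have huv : u = (τ : ℂ) • v + D v := (hSS' u).symm
      have h1 : (inner ℂ u u : ℂ) = τ * inner ℂ u v + inner ℂ u (D v) := by
        conv_lhs => rw [show (inner ℂ u u : ℂ) = inner ℂ u ((τ : ℂ) • v + D v) by rw [← huv]]
        rw [inner_add_right, inner_smul_right]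
      have h2 : (inner ℂ u (D v) : ℂ) = τ * inner ℂ v (D v) + inner ℂ (D v) (D v) := by
        conv_lhs => rw [huv]
        rw [inner_add_left, inner_smul_left, Complex.conj_ofReal]
      have h3 : 0 ≤ (inner ℂ v (D v) : ℂ).re := hDpos.re_inner_nonneg_right v
      have h4 : 0 ≤ (inner ℂ (D v) (D v) : ℂ).re := inner_self_nonneg (𝕜 := ℂ)
      have h5 : (inner ℂ u u : ℂ).re = ‖u‖ ^ 2 := inner_self_eq_norm_sq (𝕜 := ℂ) u
      rw [← h5, h1, h2]
      simp only [Complex.add_re, Complex.re_ofReal_mul]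
      nlinarith
  · intro u hu
    have hu' : B u = 0 := hu
    change B (T u) = 0
    rw [hTv, hu', sub_zero, map_add, map_smul, hu', hBDv]
    simp
  · intro q hq
    -- the range of `D` lies in `ker B`, so `D` vanishes on its orthogonal complement
    have hDq : D q = 0 := by
      rw [← inner_self_eq_zero (𝕜 := ℂ)]
      have h1 : D (D q) ∈ LinearMap.ker (B : H →ₗ[ℂ] H) := hBDv (D q)
      have h2 := (Submodule.mem_orthogonal _ _).1 hq _ h1
      rw [← h2]
      exact (hDpos.isSymmetric (D q) q).symm
    have h3 : 0 ≤ (inner ℂ q (B q) : ℂ).re := hBpos.re_inner_nonneg_right q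
    have h5 : (inner ℂ q q : ℂ).re = ‖q‖ ^ 2 := inner_self_eq_norm_sq (𝕜 := ℂ) q
    rw [hTv, hDq, add_zero, inner_sub_right, inner_smul_right, Complex.sub_re,
      Complex.re_ofReal_mul, h5]
    linarith

/-! ### Multiplication operators -/

theorem norm_sq_eq_integral (u : L2) : ‖u‖ ^ 2 = ∫ z, ‖u z‖ ^ 2 ∂gam := by
  have h1 : (inner ℂ u u : ℂ) = ((‖u‖ ^ 2 : ℝ) : ℂ) := by
    rw [inner_self_eq_norm_sq_to_K]; norm_cast
  rw [L2.inner_def] at h1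
  have h2 : ∀ z, (inner ℂ (u z) (u z) : ℂ) = ((‖u z‖ ^ 2 : ℝ) : ℂ) := fun z => by
    rw [inner_self_eq_norm_sq_to_K]; norm_cast
  simp only [h2, integral_complex_ofReal] at h1
  exact (Complex.ofReal_injective h1).symm

theorem memLp_mul_of_abs_le_one {m : ℂ → ℝ} (hm : Continuous m) (hb : ∀ z, |m z| ≤ 1) (u : L2) :
    MemLp (fun z => (m z : ℂ) * u z) 2 gam := by
  refine (Lp.memLp u).mono ?_ (Eventually.of_forall fun z => ?_)
  · exact (Complex.continuous_ofReal.comp hm).aestronglyMeasurable.mul (Lp.aestronglyMeasurable u)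
  · rw [norm_mul, Complex.norm_real, Real.norm_eq_abs]
    exact mul_le_of_le_one_left (norm_nonneg _) (hb z)

/-- Multiplication by a real continuous function bounded by one, as an operator on `L²`. -/
def mulOp (m : ℂ → ℝ) (hm : Continuous m) (hb : ∀ z, |m z| ≤ 1) : L2 →L[ℂ] L2 :=
  LinearMap.mkContinuous
    { toFun := fun u => (memLp_mul_of_abs_le_one hm hb u).toLp _
      map_add' := fun u v => by
        rw [← MemLp.toLp_add]
        refine MemLp.toLp_congr _ _ ?_
        filter_upwards [Lp.coeFn_add u v] with z hz
        simp only [hz, Pi.add_apply, mul_add]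
      map_smul' := fun c u => by
        rw [RingHom.id_apply, ← MemLp.toLp_const_smul]
        refine MemLp.toLp_congr _ _ ?_
        filter_upwards [Lp.coeFn_smul c u] with z hz
        simp only [hz, Pi.smul_apply, smul_eq_mul, mul_left_comm] }
    1 (fun u => by
      rw [one_mul]
      refine Lp.norm_le_norm_of_ae_le ?_
      filter_upwards [(memLp_mul_of_abs_le_one hm hb u).coeFn_toLp] with z hz
      change ‖((memLp_mul_of_abs_le_one hm hb u).toLp _ : L2) z‖ ≤ _
      rw [hz, norm_mul, Complex.norm_real, Real.norm_eq_abs]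
      exact mul_le_of_le_one_left (norm_nonneg _) (hb z))

section mulOp

variable {m : ℂ → ℝ} (hm : Continuous m) (hb : ∀ z, |m z| ≤ 1)

theorem coeFn_mulOp (u : L2) : (mulOp m hm hb u : ℂ → ℂ) =ᵐ[gam] fun z => (m z : ℂ) * u z :=
  (memLp_mul_of_abs_le_one hm hb u).coeFn_toLp

theorem norm_mulOp_le : ‖mulOp m hm hb‖ ≤ 1 :=
  LinearMap.mkContinuous_norm_le _ zero_le_one _

theorem inner_mulOp (u v : L2) : inner ℂ (mulOp m hm hb u) v = inner ℂ u (mulOp m hm hb v) := by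
  rw [L2.inner_def, L2.inner_def]
  refine integral_congr_ae ?_
  filter_upwards [coeFn_mulOp hm hb u, coeFn_mulOp hm hb v] with z hu hv
  rw [hu, hv, RCLike.inner_apply, RCLike.inner_apply, map_mul]
  change _ * (conj ((m z : ℝ) : ℂ) * _) = _
  rw [Complex.conj_ofReal]
  ring

end mulOp

/-! ### The resolvent of the Toeplitz operator and quasimodes -/

/-- With `T = (H_N + c)⁻¹`, the spectral subspace of `T` for `[(μ + c)⁻¹, ∞)` reduces `H_N`, and
`H_N ≤ μ` there. If `ψ` satisfies `(V - lam) ψ = r` with `lam < μ` and `r` small, then `ψ` is close to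
this subspace. Since the spectral subspace of the form contains every such subspace, no converse
inclusion is needed. -/
theorem exists_isReducingBelow_quasimode {N : ℝ} (hN : 0 < N) {V : ℂ → ℝ} (hV : Continuous V)
    {c μ : ℝ} (hc : ∀ z, 1 ≤ V z + c) (hμ : 0 < μ + c) :
    ∃ E, IsReducingBelow N V μ E ∧ ∀ ψ ∈ fockSpace N, ∀ (r : L2) (lam : ℝ), 0 ≤ lam + c →
      (r : ℂ → ℂ) =ᵐ[gam] (fun z => ((V z - lam : ℝ) : ℂ) * ψ z) →
      ∃ e ∈ E, (1 - (lam + c) / (μ + c)) * ‖ψ - e‖ ≤ ‖r‖ := by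
  have hpos : ∀ z, 0 < V z + c := fun z => one_pos.trans_le (hc z)
  set m : ℂ → ℝ := fun z => (√(V z + c))⁻¹ with hm_def
  have hsq1 : ∀ z, 1 ≤ √(V z + c) := fun z => Real.one_le_sqrt.2 (hc z)
  have hsq0 : ∀ z, 0 < √(V z + c) := fun z => one_pos.trans_le (hsq1 z)
  have hm : Continuous m :=
    (Real.continuous_sqrt.comp (hV.add continuous_const)).inv₀ fun z => (hsq0 z).ne'
  have hb : ∀ z, |m z| ≤ 1 := fun z => by
    rw [abs_of_pos (inv_pos.2 (hsq0 z))]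
    exact inv_le_one_of_one_le₀ (hsq1 z)
  have hmm : ∀ z, (V z + c) * (m z * m z) = 1 := fun z => by
    have := Real.mul_self_sqrt (hpos z).le
    have h0 := (hsq0 z).ne'
    simp only [hm_def]
    rw [← mul_inv, this, mul_inv_cancel₀ (hpos z).ne']
  set M := mulOp m hm hb with hM
  have hMM : ∀ u v : L2, inner ℂ (M u) v = inner ℂ u (M v) := inner_mulOp hm hb
  have hMv : ∀ u : L2, (M u : ℂ → ℂ) =ᵐ[gam] fun z => (m z : ℂ) * u z := coeFn_mulOp hm hb
  -- `G` is the image of the form domain under `u ↦ √(V + c) u`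
  set G : Submodule ℂ L2 := (fockSpace N).comap (M : L2 →ₗ[ℂ] L2) with hG
  have hGcl : IsClosed (G : Set L2) := (isClosed_fockSpace hN).preimage M.continuous
  have : CompleteSpace G := hGcl.completeSpace_coe
  set p : L2 →L[ℂ] L2 := G.starProjection with hp
  have hpG : ∀ u, p u ∈ G := fun u => G.starProjection_apply_mem u
  have hpp : ∀ u v : L2, inner ℂ (p u) v = inner ℂ u (p v) :=
    fun u v => G.inner_starProjection_left_eq_right u v
  set T : L2 →L[ℂ] L2 := M * p * M with hT
  have hTv : ∀ u, T u = M (p (M u)) := fun u => rfl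
  have hTT : ∀ u v : L2, inner ℂ (T u) v = inner ℂ u (T v) := fun u v => by
    rw [hTv, hTv, hMM, hpp, hMM]
  have hTsa : IsSelfAdjoint T := by
    rw [ContinuousLinearMap.isSelfAdjoint_iff_isSymmetric]
    exact fun u v => hTT u v
  have hTnorm : ∀ u, ‖T u‖ ≤ ‖u‖ := by
    have h1 : ∀ u, ‖M u‖ ≤ ‖u‖ := fun u => by
      simpa using M.le_of_opNorm_le (norm_mulOp_le hm hb) u
    have h2 : ∀ u, ‖p u‖ ≤ ‖u‖ := fun u => by
      simpa using p.le_of_opNorm_le G.starProjection_norm_le u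
    exact fun u => (h1 _).trans ((h2 _).trans (h1 _))
  have hTfock : ∀ u, T u ∈ fockSpace N := fun u => hpG (M u)
  -- the form domain condition for elements of the range of `M`
  have hdom : ∀ w : L2, Integrable (fun z => (V z + c) * ‖M w z‖ ^ 2) gam := by
    intro w
    have h1 : Integrable (fun z => ‖w z‖ ^ 2) gam :=
      (memLp_two_iff_integrable_sq_norm (Lp.aestronglyMeasurable w)).1 (Lp.memLp w)
    refine h1.congr ?_
    filter_upwards [hMv w] with z hz
    rw [hz, norm_mul, Complex.norm_real, mul_pow, Real.norm_eq_abs, sq_abs, pow_two (m z),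
      ← mul_assoc, hmm, one_mul]
  have hsqint : ∀ u : L2, Integrable (fun z => ‖u z‖ ^ 2) gam := fun u =>
    (memLp_two_iff_integrable_sq_norm (Lp.aestronglyMeasurable u)).1 (Lp.memLp u)
  have hTdom : ∀ u, T u ∈ formDomain N V := by
    intro u
    refine ⟨hTfock u, ?_⟩
    refine ((hdom (p (M u))).sub ((hsqint (T u)).const_mul c)).congr (Eventually.of_forall ?_)
    intro z
    simp only [Pi.sub_apply]
    rw [hTv]
    ring
  -- every element of the form domain is `M w` with `w ∈ G`
  have hlift : ∀ v ∈ formDomain N V, ∃ w ∈ G, M w = v := by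
    rintro v ⟨hv, hvi⟩
    have hmeas : AEStronglyMeasurable (fun z => (√(V z + c) : ℂ) * v z) gam :=
      (Complex.continuous_ofReal.comp (Real.continuous_sqrt.comp
        (hV.add continuous_const))).aestronglyMeasurable.mul (Lp.aestronglyMeasurable v)
    have hml : MemLp (fun z => (√(V z + c) : ℂ) * v z) 2 gam := by
      rw [memLp_two_iff_integrable_sq_norm hmeas]
      refine (hvi.add ((hsqint v).const_mul c)).congr (Eventually.of_forall fun z => ?_)
      simp only [Pi.add_apply]
      rw [norm_mul, Complex.norm_real, mul_pow, Real.norm_eq_abs, sq_abs,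
        Real.sq_sqrt (hpos z).le]
      ring
    have hMw : M (hml.toLp _) = v := by
      refine Lp.ext ?_
      filter_upwards [hMv (hml.toLp _), hml.coeFn_toLp] with z h1 h2
      rw [h1, h2, ← mul_assoc, ← Complex.ofReal_mul]
      simp only [hm_def]
      rw [inv_mul_cancel₀ (hsq0 z).ne', Complex.ofReal_one, one_mul]
    refine ⟨hml.toLp _, ?_, hMw⟩
    change M (hml.toLp _) ∈ fockSpace N
    rw [hMw]
    exact hv
  -- the form in terms of the resolvent `T = (H + c)⁻¹`
  have hform : ∀ f : L2, ∀ v ∈ formDomain N V,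
      toeplitzForm V (T f) v = inner ℂ f v - c * inner ℂ (T f) v := by
    intro f v hv
    obtain ⟨w, hw, rfl⟩ := hlift v hv
    have h1 : inner ℂ f (M w) = ∫ z, ((V z + c : ℝ) : ℂ) * (conj (T f z) * M w z) ∂gam := by
      rw [← hMM, ← G.starProjection_eq_self_iff.2 hw, ← hp, ← hpp, L2.inner_def]
      refine integral_congr_ae ?_
      have h2 := hMv (p (M f))
      rw [hp, G.starProjection_eq_self_iff.2 hw]
      filter_upwards [h2, hMv w] with z h2 h3
      rw [hTv, h2, h3, RCLike.inner_apply, map_mul, Complex.conj_ofReal]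
      have h4 : ((V z + c : ℝ) : ℂ) * (m z * m z) = 1 := by exact_mod_cast hmm z
      linear_combination (-(w z * conj (p (M f) z))) * h4
    have hi2 : Integrable (fun z => (conj (T f z) * M w z)) gam := by
      refine (L2.integrable_inner (𝕜 := ℂ) (T f) (M w)).congr (Eventually.of_forall fun z => ?_)
      simp only [RCLike.inner_apply]
      ring
    have hi1 : Integrable (fun z => ((V z + c : ℝ) : ℂ) * (conj (T f z) * M w z)) gam := by
      refine (L2.integrable_inner (𝕜 := ℂ) (p (M f)) w).congr ?_
      filter_upwards [hMv (p (M f)), hMv w] with z h2 h3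
      rw [hTv, h2, h3, RCLike.inner_apply, map_mul, Complex.conj_ofReal]
      have h4 : ((V z + c : ℝ) : ℂ) * (m z * m z) = 1 := by exact_mod_cast hmm z
      linear_combination (-(w z * conj (p (M f) z))) * h4
    have h5 : inner ℂ (T f) (M w) = ∫ z, (conj (T f z) * M w z) ∂gam := by
      rw [L2.inner_def]
      refine integral_congr_ae (Eventually.of_forall fun z => ?_)
      simp only [RCLike.inner_apply]
      ring
    rw [h1, h5, toeplitzForm, ← integral_const_mul, ← integral_sub hi1 (hi2.const_mul _)]
    refine integral_congr_ae (Eventually.of_forall fun z => ?_)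
    simp only
    push_cast
    ring
  have hτ : 0 < (μ + c)⁻¹ := inv_pos.2 hμ
  obtain ⟨E, hEcl, hEinv, hET, hEorth⟩ := exists_spectral_splitting hTsa hτ
  refine ⟨E, ⟨hEcl, ?_, ?_, ?_⟩, ?_⟩
  · intro u hu
    obtain ⟨v, -, rfl, -⟩ := hEinv u hu
    exact hTdom v
  · intro u hu v hv horth
    obtain ⟨f, hf, rfl, -⟩ := hEinv u hu
    rw [hform f v hv, horth f hf, horth _ hu, mul_zero, sub_zero]
  · intro u hu
    obtain ⟨f, hf, hfu, hle⟩ := hEinv u hu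
    have hnn : (inner ℂ u u : ℂ).re = ‖u‖ ^ 2 := inner_self_eq_norm_sq (𝕜 := ℂ) u
    have h1 := hform f u (hfu ▸ hTdom f)
    rw [hfu] at h1
    rw [h1, Complex.sub_re, Complex.re_ofReal_mul, hnn]
    have h2 : (inner ℂ f u : ℂ).re = (inner ℂ u f : ℂ).re := inner_re_symm (𝕜 := ℂ) f u
    rw [inv_mul_le_iff₀ hμ] at hle
    rw [h2]
    linarith
  · intro ψ hψ r lam hlam hr
    have : CompleteSpace E := hEcl.completeSpace_coe
    refine ⟨E.starProjection ψ, E.starProjection_apply_mem ψ, ?_⟩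
    set q := ψ - E.starProjection ψ with hq
    have hqE : q ∈ Eᗮ := E.sub_starProjection_mem_orthogonal ψ
    -- `ψ = T ((V + c) ψ)`
    have hψT : ψ = T (((lam + c : ℝ) : ℂ) • ψ + r) := by
      have hrw : (((((lam + c : ℝ) : ℂ) • ψ + r : L2)) : ℂ → ℂ) =ᵐ[gam]
          fun z => ((V z + c : ℝ) : ℂ) * ψ z := by
        filter_upwards [Lp.coeFn_add (((lam + c : ℝ) : ℂ) • ψ) r,
          Lp.coeFn_smul ((lam + c : ℝ) : ℂ) ψ, hr] with z h1 h2 h3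
        rw [h1, Pi.add_apply, h2, Pi.smul_apply, h3, smul_eq_mul]
        push_cast
        ring
      have hψdom : ψ ∈ formDomain N V := by
        refine ⟨hψ, ?_⟩
        have h1 := (L2.integrable_inner (𝕜 := ℂ) ψ r).norm.add ((hsqint ψ).const_mul |lam|)
        refine h1.mono' (hV.aestronglyMeasurable.mul
          ((Lp.aestronglyMeasurable ψ).norm.pow 2)) ?_
        filter_upwards [hr] with z hz
        simp only [Pi.add_apply]
        rw [hz, RCLike.inner_apply]
        simp only [norm_mul, norm_pow, Complex.norm_real, Real.norm_eq_abs, abs_norm,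
          RCLike.norm_conj]
        have : |V z| ≤ |V z - lam| + |lam| := by
          simpa using abs_add_le (V z - lam) lam
        nlinarith [sq_nonneg ‖ψ z‖]
      obtain ⟨w, hw, hMw⟩ := hlift ψ hψdom
      have h1 : M (((lam + c : ℝ) : ℂ) • ψ + r) = w := by
        refine Lp.ext ?_
        have h5 := hMv w
        rw [hMw] at h5
        filter_upwards [hMv (((lam + c : ℝ) : ℂ) • ψ + r), hrw, h5] with z h2 h3 h4
        rw [h2, h3, h4]
        have h4 : ((V z + c : ℝ) : ℂ) * (m z * m z) = 1 := by exact_mod_cast hmm z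
        linear_combination (w z) * h4
      rw [hTv, h1, hp, G.starProjection_eq_self_iff.2 hw, hMw]
    have hTq : inner ℂ q (T ψ) = inner ℂ q (T q) := by
      have h1 : ψ = q + E.starProjection ψ := by rw [hq, sub_add_cancel]
      have h2 : inner ℂ q (T (E.starProjection ψ)) = 0 :=
        (Submodule.mem_orthogonal' _ _).1 hqE _ (hET _ (E.starProjection_apply_mem ψ))
      conv_lhs => rw [h1]
      rw [map_add, inner_add_right, h2, add_zero]
    have hqψ : inner ℂ q ψ = inner ℂ q q := by
      have h2 : inner ℂ q (E.starProjection ψ) = 0 :=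
        (Submodule.mem_orthogonal' _ _).1 hqE _ (E.starProjection_apply_mem ψ)
      conv_rhs => rw [hq]
      rw [← hq, inner_sub_right, h2, sub_zero]
    have hnn : (inner ℂ q q : ℂ).re = ‖q‖ ^ 2 := inner_self_eq_norm_sq (𝕜 := ℂ) q
    have h1 : ‖q‖ ^ 2 = (lam + c) * (inner ℂ q (T q)).re + (inner ℂ q (T r)).re := by
      rw [← hnn, ← hqψ]
      conv_lhs => rw [hψT]
      rw [map_add, map_smul, inner_add_right, inner_smul_right, hTq, Complex.add_re,
        Complex.re_ofReal_mul]
    have h2 : (inner ℂ q (T r)).re ≤ ‖q‖ * ‖r‖ :=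
      (Complex.re_le_norm _).trans ((norm_inner_le_norm _ _).trans
        (mul_le_mul_of_nonneg_left (hTnorm r) (norm_nonneg _)))
    have h3 := mul_le_mul_of_nonneg_left (hEorth q hqE) hlam
    have h4 : (1 - (lam + c) / (μ + c)) * ‖q‖ ^ 2 ≤ ‖q‖ * ‖r‖ := by
      rw [div_eq_mul_inv]
      nlinarith
    rcases (norm_nonneg q).eq_or_lt with h0 | h0
    · rw [← h0, mul_zero]
      exact norm_nonneg r
    · refine le_of_mul_le_mul_left ?_ h0
      linarith

/-! ### Growth of the potential -/

/-- A global Lipschitz-type bound for `V`, centred at a point of `{V ≤ μ}`: Lipschitz continuity near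
this compact set, and exponential growth elsewhere because `log (V - μ)` is Lipschitz. -/
theorem PotentialAssumption.exists_growth {V : ℂ → ℝ} {μ δ : ℝ} (h : PotentialAssumption V μ δ) :
    ∃ L a : ℝ, 0 ≤ L ∧ 0 ≤ a ∧ ∀ x, V x ≤ μ → ∀ y,
      |V y - V x| ≤ L * ‖y - x‖ * Real.exp (a * ‖y - x‖) := by
  obtain ⟨K, hK⟩ := h.lipschitz_log
  have hδ := h.pos
  have hcpt : IsCompact {z | V z ≤ μ} :=
    h.isCompact.of_isClosed_subset (isClosed_le h.continuous continuous_const)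
      (fun z (hz : V z ≤ μ) => by simp only [Set.mem_ofPred_eq]; linarith)
  -- exponential growth, uniformly in the base point
  obtain ⟨B, hB⟩ := h.isCompact.exists_bound_of_continuousOn h.continuous.continuousOn
  obtain ⟨R, hR⟩ := hcpt.isBounded.exists_norm_le
  have hgrow : ∃ A : ℝ, 0 ≤ A ∧ ∀ x, V x ≤ μ → ∀ y,
      |V y - V x| ≤ A * Real.exp (K * ‖y - x‖) := by
    by_cases hne : ∃ y₀, μ + δ ≤ V y₀
    · obtain ⟨y₀, hy₀⟩ := hne
      refine ⟨2 * |B| + |μ| + Real.exp (Real.log (V y₀ - μ) + K * (|R| + ‖y₀‖)), by positivity, ?_⟩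
      intro x hx y
      have hVx : |V x| ≤ |B| := (hB x (by simp only [Set.mem_ofPred_eq]; linarith)).trans
        (le_abs_self B)
      have he : 1 ≤ Real.exp (K * ‖y - x‖) := Real.one_le_exp (by positivity)
      have hBn := abs_nonneg B
      have hμn := abs_nonneg μ
      rw [add_mul]
      have hE0 : 0 < Real.exp (Real.log (V y₀ - μ) + K * (|R| + ‖y₀‖)) := Real.exp_pos _
      by_cases hy : V y ≤ μ + δ
      · have hVy : |V y| ≤ |B| := (hB y hy).trans (le_abs_self B)
        have h1 : |V y - V x| ≤ 2 * |B| := by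
          have := abs_sub (V y) (V x)
          linarith
        nlinarith
      · push Not at hy
        have hd := hK.dist_le_mul y hy.le y₀ hy₀
        rw [Real.dist_eq, dist_eq_norm] at hd
        have hd' := (abs_le.1 hd).2
        have hn : ‖y - y₀‖ ≤ ‖y - x‖ + (|R| + ‖y₀‖) := by
          have h1 : y - y₀ = (y - x) + (x - y₀) := by ring
          have h2 := norm_add_le (y - x) (x - y₀)
          have h3 := norm_sub_le x y₀
          have h4 := (hR x hx).trans (le_abs_self R)
          rw [h1]
          linarith
        have hVy : V y - μ ≤ Real.exp (Real.log (V y₀ - μ) + K * (|R| + ‖y₀‖)) *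
            Real.exp (K * ‖y - x‖) := by
          rw [← Real.exp_add, ← Real.log_le_iff_le_exp (by linarith)]
          have := mul_le_mul_of_nonneg_left hn K.coe_nonneg
          linarith
        have h5 : |V y - V x| ≤ |V y - μ| + |μ - V x| := by
          have := abs_add_le (V y - μ) (μ - V x)
          simpa using this
        have h6 : |μ - V x| ≤ |μ| + |B| := (abs_sub μ (V x)).trans (by linarith)
        rw [abs_of_pos (by linarith : 0 < V y - μ)] at h5
        nlinarith
    · push Not at hne
      refine ⟨2 * |B|, by positivity, fun x hx y => ?_⟩
      have hVx : |V x| ≤ |B| := (hB x (hne x).le).trans (le_abs_self B)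
      have hVy : |V y| ≤ |B| := (hB y (hne y).le).trans (le_abs_self B)
      have he : 1 ≤ Real.exp (K * ‖y - x‖) := Real.one_le_exp (by positivity)
      have hBn := abs_nonneg B
      have h1 : |V y - V x| ≤ 2 * |B| := by
        have := abs_sub (V y) (V x)
        linarith
      nlinarith
  obtain ⟨A, hA0, hA⟩ := hgrow
  -- the Lipschitz bound near the compact set `{V ≤ μ}`
  have hopen : IsOpen {z | V z < μ + δ} := isOpen_lt h.continuous continuous_const
  obtain ⟨r, hr0, hr⟩ := hcpt.exists_cthickening_subset_open hopen
    (fun z (hz : V z ≤ μ) => by simp only [Set.mem_ofPred_eq]; linarith)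
  obtain ⟨L, hL⟩ := (h.locallyLipschitz.mono hr).exists_lipschitzOnWith_of_compact
    hcpt.cthickening
  refine ⟨L + A / r, K, by positivity, K.coe_nonneg, fun x hx y => ?_⟩
  have he : 1 ≤ Real.exp (K * ‖y - x‖) := Real.one_le_exp (by positivity)
  by_cases hxy : ‖y - x‖ ≤ r
  · have hym : y ∈ Metric.cthickening r {z | V z ≤ μ} :=
      Metric.mem_cthickening_of_dist_le y x r _ hx (by rwa [dist_eq_norm])
    have hxm : x ∈ Metric.cthickening r {z | V z ≤ μ} := Metric.self_subset_cthickening _ hx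
    have h1 := hL.dist_le_mul y hym x hxm
    rw [Real.dist_eq, dist_eq_norm] at h1
    have h2 : 0 ≤ A / r * ‖y - x‖ := by positivity
    have h3 : 0 ≤ (L + A / r) * ‖y - x‖ := by positivity
    nlinarith
  · push Not at hxy
    refine (hA x hx y).trans (mul_le_mul_of_nonneg_right ?_ (Real.exp_pos _).le)
    have h1 : A = A / r * r := by field_simp
    have h2 : A / r * r ≤ A / r * ‖y - x‖ := mul_le_mul_of_nonneg_left hxy.le (by positivity)
    have h3 : 0 ≤ (L : ℝ) * ‖y - x‖ := by positivity
    rw [add_mul]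
    linarith

theorem PotentialAssumption.exists_add_ge_one {V : ℂ → ℝ} {μ δ : ℝ}
    (h : PotentialAssumption V μ δ) : ∃ c : ℝ, 0 < μ + c ∧ ∀ z, 1 ≤ V z + c := by
  obtain ⟨B, hB⟩ := h.isCompact.exists_bound_of_continuousOn h.continuous.continuousOn
  refine ⟨|B| + |μ| + 1, ?_, fun z => ?_⟩
  · have := neg_abs_le μ
    have := abs_nonneg B
    linarith
  · by_cases hz : V z ≤ μ + δ
    · have h1 := (abs_le.1 (hB z hz)).1
      have := le_abs_self B
      have := abs_nonneg μ
      linarith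
    · push Not at hz
      have := h.pos
      have := neg_abs_le μ
      have := abs_nonneg B
      linarith

/-! ### Coherent states as quasimodes -/

/-- Coherent states are Gaussians centred at their base point. -/
theorem norm_ginibreKernel_sq (N : ℝ) (w z : ℂ) :
    ‖ginibreKernel N w z‖ ^ 2 = N ^ 2 * Real.exp (-N * ‖w - z‖ ^ 2) := by
  simp only [ginibreKernel, norm_mul, Complex.norm_exp, Complex.norm_real, Real.norm_eq_abs,
    mul_pow, sq_abs]
  rw [← Real.exp_nat_mul]
  congr 2
  simp only [← Complex.ofReal_pow, ← Complex.normSq_eq_norm_sq, Complex.normSq_apply,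
    Complex.sub_re, Complex.sub_im, Complex.mul_re, Complex.conj_re,
    Complex.conj_im]
  norm_num [Complex.div_re, Complex.normSq_apply]
  ring

theorem integrable_sq_mul_exp_mul_gaussian (a : ℝ) :
    Integrable fun u : ℂ => ‖u‖ ^ 2 * Real.exp (2 * a * ‖u‖) * Real.exp (-‖u‖ ^ 2) := by
  have h := ((GaussianFourier.integrable_cexp_neg_mul_sq_norm_add (V := ℂ) (b := ((1 / 2 : ℝ) : ℂ))
    (by norm_num) 0 0).norm).const_mul (4 * Real.exp (4 * a ^ 2))
  refine h.mono' (by fun_prop) (Eventually.of_forall fun u => ?_)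
  rw [Real.norm_eq_abs, abs_of_nonneg (by positivity), Complex.norm_exp]
  have h1 : (-((1 / 2 : ℝ) : ℂ) * (‖u‖ : ℂ) ^ 2 + 0 * ((inner ℝ (0 : ℂ) u : ℝ) : ℂ)).re
      = -(1 / 2) * ‖u‖ ^ 2 := by
    rw [zero_mul, add_zero, ← Complex.ofReal_pow, ← Complex.ofReal_neg, ← Complex.ofReal_mul,
      Complex.ofReal_re]
  rw [h1]
  have h2 : ‖u‖ ^ 2 ≤ 4 * Real.exp (‖u‖ ^ 2 / 4) := by
    have := Real.add_one_le_exp (‖u‖ ^ 2 / 4)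
    linarith
  calc ‖u‖ ^ 2 * Real.exp (2 * a * ‖u‖) * Real.exp (-‖u‖ ^ 2)
      ≤ 4 * Real.exp (‖u‖ ^ 2 / 4) * Real.exp (2 * a * ‖u‖) * Real.exp (-‖u‖ ^ 2) := by gcongr
    _ = 4 * Real.exp (‖u‖ ^ 2 / 4 + 2 * a * ‖u‖ + -‖u‖ ^ 2) := by
        rw [Real.exp_add, Real.exp_add]; ring
    _ ≤ 4 * Real.exp (4 * a ^ 2 + -(1 / 2) * ‖u‖ ^ 2) := by
        refine mul_le_mul_of_nonneg_left (Real.exp_le_exp.2 ?_) (by norm_num)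
        nlinarith [sq_nonneg (‖u‖ / 2 - 2 * a)]
    _ = _ := by rw [Real.exp_add]; ring

/-- Multiplying the coherent state at `x`, whose norm is `√N`, by a function that vanishes linearly at
`x` and grows at most exponentially gives a vector of norm `O(1)`. -/
theorem exists_norm_mul_reproducing_le {a : ℝ} (ha : 0 ≤ a) :
    ∃ D : ℝ, 0 ≤ D ∧ ∀ N : ℝ, 1 ≤ N → ∀ (x : ℂ) (L : ℝ), 0 ≤ L → ∀ h : ℂ → ℝ, Continuous h →
      (∀ y, |h y| ≤ L * ‖y - x‖ * Real.exp (a * ‖y - x‖)) →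
      ∃ r : L2, (r : ℂ → ℂ) =ᵐ[gam] (fun y => (h y : ℂ) * reproducing N x y) ∧ ‖r‖ ≤ L * D := by
  set f : ℂ → ℝ := fun u => ‖u‖ ^ 2 * Real.exp (2 * a * ‖u‖) * Real.exp (-‖u‖ ^ 2) with hf
  have hfint : Integrable f := integrable_sq_mul_exp_mul_gaussian a
  have hI : 0 ≤ ∫ u, f u := integral_nonneg fun u => by positivity
  refine ⟨√(1 / Real.pi * ∫ u, f u), Real.sqrt_nonneg _, fun N hN x L hL h hh hbd => ?_⟩
  have hN0 : 0 < N := one_pos.trans_le hN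
  have hcont : Continuous fun y => (h y : ℂ) * ginibreKernel N y x := by
    unfold ginibreKernel
    fun_prop
  set F : ℂ → ℝ := fun y => L ^ 2 * N * f (√N • (y - x)) with hF
  have hFint : Integrable F := by
    have h1 : Integrable fun s : ℂ => f (√N • s) := hfint.comp_smul (Real.sqrt_pos.2 hN0).ne'
    exact (h1.comp_sub_right x).const_mul _
  have hle : ∀ y, ‖(h y : ℂ) * ginibreKernel N y x‖ ^ 2 ≤ F y := by
    intro y
    have hs : ‖√N • (y - x)‖ = √N * ‖y - x‖ := by
      rw [norm_smul, Real.norm_eq_abs, abs_of_nonneg (Real.sqrt_nonneg N)]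
    have h1N : 1 ≤ √N := Real.one_le_sqrt.2 hN
    rw [norm_mul, mul_pow, norm_ginibreKernel_sq, Complex.norm_real, Real.norm_eq_abs]
    have h1 : |h y| ^ 2 ≤ L ^ 2 * ‖y - x‖ ^ 2 * Real.exp (2 * a * ‖y - x‖) := by
      have := pow_le_pow_left₀ (abs_nonneg _) (hbd y) 2
      refine this.trans (le_of_eq ?_)
      rw [mul_pow, mul_pow, ← Real.exp_nat_mul]
      congr 2
      push_cast
      ring
    have h2 : Real.exp (2 * a * ‖y - x‖) ≤ Real.exp (2 * a * (√N * ‖y - x‖)) := by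
      gcongr
      exact le_mul_of_one_le_left (norm_nonneg _) h1N
    simp only [hF, hf, hs, mul_pow, Real.sq_sqrt hN0.le]
    calc |h y| ^ 2 * (N ^ 2 * Real.exp (-N * ‖y - x‖ ^ 2))
        ≤ (L ^ 2 * ‖y - x‖ ^ 2 * Real.exp (2 * a * (√N * ‖y - x‖))) *
          (N ^ 2 * Real.exp (-N * ‖y - x‖ ^ 2)) := by
          refine mul_le_mul_of_nonneg_right (h1.trans ?_) (by positivity)
          gcongr
      _ = _ := by rw [neg_mul]; ring
  have hml : MemLp (fun y => (h y : ℂ) * ginibreKernel N y x) 2 gam := by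
    rw [memLp_two_iff_integrable_sq_norm hcont.aestronglyMeasurable, integrable_gam_iff]
    refine hFint.mono' (hcont.norm.pow 2).aestronglyMeasurable (Eventually.of_forall fun y => ?_)
    rw [norm_pow, norm_norm]
    exact hle y
  refine ⟨hml.toLp _, ?_, ?_⟩
  · filter_upwards [hml.coeFn_toLp, coeFn_reproducing hN0 x] with y h1 h2
    rw [h1, h2]
  · have h1 : ‖hml.toLp _‖ ^ 2 ≤ L ^ 2 * (1 / Real.pi * ∫ u, f u) := by
      rw [norm_sq_eq_integral, integral_congr_ae (g := fun y => ‖(h y : ℂ) * ginibreKernel N y x‖ ^ 2)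
        (by filter_upwards [hml.coeFn_toLp] with y hy; rw [hy]), integral_gam, smul_eq_mul]
      have h2 : ∫ y, ‖(h y : ℂ) * ginibreKernel N y x‖ ^ 2 ≤ ∫ y, F y :=
        integral_mono_of_nonneg (Eventually.of_forall fun y => by positivity) hFint
          (Eventually.of_forall hle)
      have h3 : ∫ y, F y = L ^ 2 * ∫ u, f u := by
        simp only [hF]
        rw [integral_const_mul, integral_sub_right_eq_self (fun s => f (√N • s)) x,
          Measure.integral_comp_smul, Complex.finrank_real_complex, Real.sq_sqrt hN0.le,
          abs_of_pos (inv_pos.2 hN0), smul_eq_mul]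
        field_simp
      rw [h3] at h2
      have := mul_le_mul_of_nonneg_left h2 (by positivity : 0 ≤ 1 / Real.pi)
      linarith
    refine abs_le_of_sq_le_sq' ?_ (by positivity) |>.2
    rw [mul_pow, Real.sq_sqrt (by positivity)]
    exact h1

/-! ### Convergence of the rescaled kernels in the bulk -/

theorem microscale_pos {N : ℝ} (hN : 0 < N) : 0 < microscale N := Real.rpow_pos_of_pos hN _

theorem microscale_eq_inv_sqrt {N : ℝ} (hN : 0 < N) : microscale N = (√N)⁻¹ := by
  rw [microscale, Real.rpow_neg hN.le, Real.sqrt_eq_rpow]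

theorem microscale_sq {N : ℝ} (hN : 0 < N) : microscale N ^ 2 = N⁻¹ := by
  rw [microscale_eq_inv_sqrt hN, inv_pow, Real.sq_sqrt hN.le]

theorem microscale_le_one {N : ℝ} (hN : 1 ≤ N) : microscale N ≤ 1 := by
  rw [microscale_eq_inv_sqrt (one_pos.trans_le hN)]
  exact inv_le_one_of_one_le₀ (Real.one_le_sqrt.2 hN)

theorem spectralKernel_eq_inner (N : ℝ) (V : ℂ → ℝ) (μ : ℝ) (x z : ℂ) :
    spectralKernel N V μ x z = inner ℂ (spectralProjection N V μ (reproducing N x))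
      (spectralProjection N V μ (reproducing N z)) := by
  rw [spectralKernel, spectralProjection, Submodule.inner_starProjection_left_eq_right,
    Submodule.starProjection_eq_self_iff.2 (Submodule.starProjection_apply_mem _ _)]

theorem IsReducingBelow.le_spectralSubspace {N : ℝ} {V : ℂ → ℝ} {μ : ℝ} {E : Submodule ℂ L2}
    (h : IsReducingBelow N V μ E) : E ≤ spectralSubspace N V μ :=
  (le_sSup (show E ∈ {E | IsReducingBelow N V μ E} from h)).trans
    (Submodule.le_topologicalClosure _)

theorem norm_sub_spectralProjection_le (N : ℝ) (V : ℂ → ℝ) (μ : ℝ) (ψ : L2) {e : L2}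
    (he : e ∈ spectralSubspace N V μ) : ‖ψ - spectralProjection N V μ ψ‖ ≤ ‖ψ - e‖ := by
  rw [spectralProjection, Submodule.starProjection_minimal]
  exact ciInf_le ⟨0, by rintro _ ⟨y, rfl⟩; exact norm_nonneg _⟩
    (⟨e, he⟩ : spectralSubspace N V μ)

/-- On the Fock space `P_N - Π_N` acts as `1 - Π_N`, so its kernel obeys a Cauchy--Schwarz bound. -/
theorem norm_spectralKernel_sub_le {N : ℝ} (hN : 0 < N) (V : ℂ → ℝ) (μ : ℝ) (x z : ℂ) :
    ‖spectralKernel N V μ x z - ginibreKernel N x z‖ ≤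
      ‖reproducing N x - spectralProjection N V μ (reproducing N x)‖ *
      ‖reproducing N z - spectralProjection N V μ (reproducing N z)‖ := by
  have h : ginibreKernel N x z - spectralKernel N V μ x z =
      inner ℂ (reproducing N x - spectralProjection N V μ (reproducing N x))
        (reproducing N z - spectralProjection N V μ (reproducing N z)) := by
    have h1 : inner ℂ (spectralProjection N V μ (reproducing N x)) (reproducing N z)
        = spectralKernel N V μ x z := by
      rw [spectralKernel, spectralProjection, Submodule.inner_starProjection_left_eq_right]
    rw [inner_sub_left, inner_sub_right, inner_sub_right, h1, ← spectralKernel_eq_inner,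
      inner_reproducing_reproducing hN, ← spectralKernel]
    ring
  rw [norm_sub_rev, h]
  exact norm_inner_le_norm _ _

/-- The coherent state at `x` is a quasimode of energy `V x` with error `O(1)`, to be compared with its
norm `√N`. -/
theorem PotentialAssumption.exists_norm_sub_spectralProjection_le {V : ℂ → ℝ} {μ δ : ℝ}
    (h : PotentialAssumption V μ δ) :
    ∃ B : ℝ, 0 ≤ B ∧ ∀ N, 1 ≤ N → ∀ x, V x < μ →
      ‖reproducing N x - spectralProjection N V μ (reproducing N x)‖ ≤ B / (μ - V x) := by
  obtain ⟨L, a, hL, ha, hgrow⟩ := h.exists_growth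
  obtain ⟨c, hμc, hc⟩ := h.exists_add_ge_one
  obtain ⟨D, hD, hcoh⟩ := exists_norm_mul_reproducing_le ha
  refine ⟨(μ + c) * (L * D), by positivity, fun N hN x hx => ?_⟩
  have hN0 : 0 < N := one_pos.trans_le hN
  obtain ⟨E, hE, hq⟩ := exists_isReducingBelow_quasimode hN0 h.continuous hc hμc
  obtain ⟨r, hr, hrn⟩ := hcoh N hN x L hL (fun y => V y - V x)
    (h.continuous.sub continuous_const) (hgrow x hx.le)
  obtain ⟨e, he, hle⟩ := hq _ (reproducing_mem_fockSpace hN0 x) r (V x)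
    (zero_le_one.trans (hc x)) hr
  refine (norm_sub_spectralProjection_le N V μ _ (hE.le_spectralSubspace he)).trans ?_
  rw [le_div_iff₀ (by linarith)]
  have h1 : 1 - (V x + c) / (μ + c) = (μ - V x) / (μ + c) := by
    field_simp
    ring
  rw [h1, div_mul_eq_mul_div, div_le_iff₀ hμc] at hle
  nlinarith

/-- In the bulk, the gap `μ - V` is at least of order `N^{-1/2} log N`, which beats the relative
quasimode error `O(N^{-1/2})` by a logarithm. -/
theorem PotentialAssumption.tendsto_spectralKernel_sub {V : ℂ → ℝ} {μ δ₀ : ℝ}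
    (h : PotentialAssumption V μ δ₀) {δ : ℝ → ℝ} {x : ℝ → ℂ}
    (hδ : ∀ᶠ N in atTop, microscale N * Real.log N ≤ δ N)
    (hx : ∀ᶠ N in atTop, x N ∈ bulk V μ (δ N)) (u v : ℂ) :
    Tendsto (fun N : ℝ => (N : ℂ)⁻¹ *
      (spectralKernel N V μ (x N + microscale N * u) (x N + microscale N * v) -
        ginibreKernel N (x N + microscale N * u) (x N + microscale N * v))) atTop (𝓝 0) := by
  obtain ⟨L, a, hL, ha, hgrow⟩ := h.exists_growth
  obtain ⟨B, hB, hproj⟩ := h.exists_norm_sub_spectralProjection_le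
  set ℓ : ℂ → ℝ := fun u => L * ‖u‖ * Real.exp (a * ‖u‖) with hℓ
  have hlog : ∀ u : ℂ, Tendsto (fun N : ℝ => B / (Real.log N - ℓ u)) atTop (𝓝 0) := fun u =>
    (tendsto_atTop_add_const_right _ (-ℓ u) Real.tendsto_log_atTop).const_div_atTop B
  have hV : ∀ u : ℂ, ∀ᶠ N in atTop,
      ‖reproducing N (x N + microscale N * u) -
        spectralProjection N V μ (reproducing N (x N + microscale N * u))‖ ≤
      √N * (B / (Real.log N - ℓ u)) := by
    intro u
    filter_upwards [hδ, hx, eventually_gt_atTop 1,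
      Real.tendsto_log_atTop.eventually_gt_atTop (ℓ u)] with N h1 h2 h3 h4
    have hN0 : 0 < N := one_pos.trans h3
    have hε := microscale_pos hN0
    have hε1 := microscale_le_one h3.le
    have hδpos : 0 < δ N := lt_of_lt_of_le (mul_pos hε (Real.log_pos h3)) h1
    have hVx : V (x N) < μ - δ N := by
      by_contra hcon
      have := h2 (x N) (not_lt.1 hcon)
      rw [dist_self] at this
      linarith
    have h5 := (le_abs_self _).trans (hgrow (x N) (by linarith) (x N + microscale N * u))
    rw [add_sub_cancel_left, norm_mul, Complex.norm_real, Real.norm_eq_abs, abs_of_pos hε] at h5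
    have h6 : L * (microscale N * ‖u‖) * Real.exp (a * (microscale N * ‖u‖)) ≤
        microscale N * ℓ u := by
      have h7 : Real.exp (a * (microscale N * ‖u‖)) ≤ Real.exp (a * ‖u‖) := by
        gcongr
        exact mul_le_of_le_one_left (norm_nonneg _) hε1
      calc L * (microscale N * ‖u‖) * Real.exp (a * (microscale N * ‖u‖))
          ≤ L * (microscale N * ‖u‖) * Real.exp (a * ‖u‖) := by gcongr
        _ = _ := by simp only [hℓ]; ring
    have h8 : microscale N * (Real.log N - ℓ u) ≤ μ - V (x N + microscale N * u) := by
      rw [mul_sub]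
      linarith
    have h9 : 0 < microscale N * (Real.log N - ℓ u) := mul_pos hε (sub_pos.2 h4)
    refine (hproj N h3.le _ (by linarith)).trans ?_
    refine (div_le_div_of_nonneg_left hB h9 h8).trans (le_of_eq ?_)
    rw [microscale_eq_inv_sqrt hN0]
    have := Real.sqrt_pos.2 hN0
    have := sub_pos.2 h4
    field_simp
  refine squeeze_zero_norm' ?_ (by simpa using (hlog u).mul (hlog v))
  filter_upwards [hV u, hV v, eventually_gt_atTop 0] with N hu hv hN
  have h1 := (norm_spectralKernel_sub_le hN V μ (x N + microscale N * u)
    (x N + microscale N * v)).trans (mul_le_mul hu hv (norm_nonneg _) ((norm_nonneg _).trans hu))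
  rw [norm_mul, norm_inv, Complex.norm_real, Real.norm_eq_abs, abs_of_pos hN,
    inv_mul_le_iff₀ hN]
  refine h1.trans (le_of_eq ?_)
  have := Real.mul_self_sqrt hN.le
  linear_combination (B / (Real.log N - ℓ u) * (B / (Real.log N - ℓ v))) * this

/-- The phase by which magnetic translation to the point `x` multiplies functions. -/
def gauge (N : ℝ) (x u : ℂ) : ℂ := Complex.exp ((√N * (u * conj x).im : ℝ) * Complex.I)

theorem gauge_mul_conj (N : ℝ) (x u : ℂ) : gauge N x u * conj (gauge N x u) = 1 := by
  rw [Complex.mul_conj', gauge, Complex.norm_exp_ofReal_mul_I]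
  simp

/-- Magnetic translation invariance of the Bergman kernel. -/
theorem ginibreKernel_rescaled {N : ℝ} (hN : 0 < N) (x u v : ℂ) :
    (N : ℂ)⁻¹ * ginibreKernel N (x + microscale N * u) (x + microscale N * v) =
      gauge N x u * ginibreKernel 1 u v * conj (gauge N x v) := by
  have hN' : (N : ℂ) ≠ 0 := by exact_mod_cast hN.ne'
  rw [ginibreKernel, ginibreKernel, gauge, gauge, ← mul_assoc, inv_mul_cancel₀ hN', one_mul,
    ← Complex.exp_conj, Complex.ofReal_one, one_mul, one_mul, ← Complex.exp_add, ← Complex.exp_add]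
  congr 1
  have hε : (N : ℂ) * (microscale N : ℂ) ^ 2 = 1 := by
    have : N * microscale N ^ 2 = 1 := by rw [microscale_sq hN, mul_inv_cancel₀ hN.ne']
    exact_mod_cast this
  have hs : (N : ℂ) * (microscale N : ℂ) = (√N : ℂ) := by
    have h0 := (Real.sqrt_pos.2 hN).ne'
    have h1 : N * microscale N = √N := by
      rw [microscale_eq_inv_sqrt hN]
      rw [mul_inv_eq_iff_eq_mul₀ h0, Real.mul_self_sqrt hN.le]
    exact_mod_cast h1
  have him : ∀ w : ℂ, ((w * conj x).im : ℂ) * Complex.I = (w * conj x - x * conj w) / 2 := by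
    intro w
    rw [Complex.im_eq_sub_conj, map_mul, Complex.conj_conj]
    have := Complex.I_ne_zero
    field_simp
  simp only [← Complex.conj_mul', map_add, map_mul, Complex.conj_ofReal, Complex.conj_I]
  push_cast
  have h1 := him u
  have h2 := him v
  linear_combination (u * conj v - u * conj u / 2 - v * conj v / 2) * hε +
    (u * conj x / 2 - x * conj u / 2 + x * conj v / 2 - v * conj x / 2) * hs
    - (√N : ℂ) * h1 + (√N : ℂ) * h2

theorem PotentialAssumption.tendsto_gauged_spectralKernel {V : ℂ → ℝ} {μ δ₀ : ℝ}
    (h : PotentialAssumption V μ δ₀) {δ : ℝ → ℝ} {x : ℝ → ℂ}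
    (hδ : ∀ᶠ N in atTop, microscale N * Real.log N ≤ δ N)
    (hx : ∀ᶠ N in atTop, x N ∈ bulk V μ (δ N)) (u v : ℂ) :
    Tendsto (fun N : ℝ => conj (gauge N (x N) u) * ((N : ℂ)⁻¹ *
      spectralKernel N V μ (x N + microscale N * u) (x N + microscale N * v)) *
        gauge N (x N) v) atTop (𝓝 (ginibreKernel 1 u v)) := by
  have h0 := h.tendsto_spectralKernel_sub hδ hx u v
  rw [tendsto_iff_norm_sub_tendsto_zero]
  refine (tendsto_zero_iff_norm_tendsto_zero.1 h0).congr' ?_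
  filter_upwards [eventually_gt_atTop 0] with N hN
  have hg : ∀ w, ‖gauge N (x N) w‖ = 1 := fun w => Complex.norm_exp_ofReal_mul_I _
  have h1 := ginibreKernel_rescaled hN (x N) u v
  have h2 := gauge_mul_conj N (x N) u
  have h3 := gauge_mul_conj N (x N) v
  have h4 : conj (gauge N (x N) u) * ((N : ℂ)⁻¹ *
      spectralKernel N V μ (x N + microscale N * u) (x N + microscale N * v)) *
        gauge N (x N) v - ginibreKernel 1 u v = conj (gauge N (x N) u) * ((N : ℂ)⁻¹ *
      (spectralKernel N V μ (x N + microscale N * u) (x N + microscale N * v) -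
        ginibreKernel N (x N + microscale N * u) (x N + microscale N * v))) *
        gauge N (x N) v := by
    rw [mul_sub (N : ℂ)⁻¹, h1]
    linear_combination (ginibreKernel 1 u v) * h2 + (ginibreKernel 1 u v) * gauge N (x N) u *
      conj (gauge N (x N) u) * h3
  rw [h4]
  simp only [norm_mul, RCLike.norm_conj, hg, one_mul, mul_one]

/-! ### Elementary symmetric functions of a finite configuration -/

/-- A set of `k` elements is the image of `k!` injective `k`-tuples. -/
theorem card_embedding_image_eq {α : Type*} [Fintype α] [DecidableEq α] {k : ℕ} {s : Finset α}
    (hs : s.card = k) :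
    (Finset.univ.filter fun p : Fin k ↪ α => Finset.univ.map p = s).card = k.factorial := by
  let e : Fin k ≃ s := (s.equivFinOfCardEq hs).symm
  have hbij : (Finset.univ : Finset (Equiv.Perm (Fin k))).card =
      (Finset.univ.filter fun p : Fin k ↪ α => Finset.univ.map p = s).card := by
    refine Finset.card_bij
      (fun σ _ => (σ.trans e).toEmbedding.trans (Function.Embedding.subtype (· ∈ s))) ?_ ?_ ?_
    · intro σ _
      rw [Finset.mem_filter]
      refine ⟨Finset.mem_univ _, ?_⟩
      ext a
      simp only [Finset.mem_map, Finset.mem_univ, true_and]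
      refine ⟨?_, fun ha => ⟨(σ.trans e).symm ⟨a, ha⟩, by simp⟩⟩
      rintro ⟨i, rfl⟩
      exact (e (σ i)).2
    · intro σ _ τ _ h
      ext i
      have h1 := DFunLike.congr_fun h i
      have h2 : e (σ i) = e (τ i) := Subtype.ext h1
      rw [e.injective h2]
    · intro p hp
      have hp' := (Finset.mem_filter.1 hp).2
      have hmem : ∀ i, p i ∈ s := fun i => by
        rw [← hp']
        exact Finset.mem_map_of_mem p (Finset.mem_univ i)
      have hinj : Function.Injective fun i => e.symm ⟨p i, hmem i⟩ := by
        intro i j hij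
        exact p.injective (congrArg Subtype.val (e.symm.injective hij))
      refine ⟨Equiv.ofBijective _ (Finite.injective_iff_bijective.1 hinj), Finset.mem_univ _, ?_⟩
      ext i
      simp
  rw [← hbij, Finset.card_univ, Fintype.card_perm, Fintype.card_fin]

theorem sum_embedding_prod {α R : Type*} [Fintype α] [CommRing R] (φ : α → R) (k : ℕ) :
    ∑ p : Fin k ↪ α, ∏ i, φ (p i) =
      k.factorial * ∑ s ∈ Finset.univ.powersetCard k, ∏ x ∈ s, φ x := by
  classical
  have hmaps : ∀ p ∈ (Finset.univ : Finset (Fin k ↪ α)),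
      Finset.univ.map p ∈ (Finset.univ : Finset α).powersetCard k := fun p _ => by
    simp [Finset.mem_powersetCard]
  rw [← Finset.sum_fiberwise_of_maps_to hmaps, Finset.mul_sum]
  refine Finset.sum_congr rfl fun s hs => ?_
  rw [← card_embedding_image_eq (Finset.mem_powersetCard.1 hs).2, ← nsmul_eq_mul,
    ← Finset.sum_const]
  refine Finset.sum_congr rfl fun p hp => ?_
  rw [← (Finset.mem_filter.1 hp).2, Finset.prod_map]

theorem sum_embedding_prod_eq_esymm {α R : Type*} [Fintype α] [CommRing R] (φ : α → R) (k : ℕ) :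
    ∑ p : Fin k ↪ α, ∏ i, φ (p i) =
      k.factorial * MvPolynomial.aeval φ (MvPolynomial.esymm α R k) := by
  rw [sum_embedding_prod, MvPolynomial.aeval_esymm_eq_multiset_esymm, Finset.esymm_map_val]

/-- Newton's identity for sums over injective tuples. -/
theorem sum_embedding_prod_newton {α : Type*} [Fintype α] (φ : α → ℂ) {k : ℕ} (hk : k ≠ 0) :
    ∑ p : Fin k ↪ α, ∏ i, φ (p i) = ((k - 1).factorial : ℂ) * ((-1) ^ (k + 1) *
      ∑ a ∈ Finset.HasAntidiagonal.antidiagonal k with a.1 < k, (-1) ^ a.1 *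
        ((a.1.factorial : ℂ)⁻¹ * ∑ p : Fin a.1 ↪ α, ∏ i, φ (p i)) * ∑ x, φ x ^ a.2) := by
  have h := congrArg (MvPolynomial.aeval φ) (MvPolynomial.mul_esymm_eq_sum α ℂ k)
  simp only [map_mul, map_sum, map_pow, map_neg, map_one, map_natCast, MvPolynomial.psum,
    MvPolynomial.aeval_X] at h
  have hf : ∀ j : ℕ, (j.factorial : ℂ) ≠ 0 := fun j => by exact_mod_cast j.factorial_ne_zero
  simp only [sum_embedding_prod_eq_esymm, inv_mul_cancel_left₀ (hf _)]
  rw [← h, ← mul_assoc, ← Nat.cast_mul, mul_comm (k - 1).factorial, Nat.mul_factorial_pred hk]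

theorem prod_one_add_eq_tsum {α : Type*} [Fintype α] (φ : α → ℂ) :
    HasSum (fun k : ℕ => (k.factorial : ℂ)⁻¹ * ∑ p : Fin k ↪ α, ∏ i, φ (p i))
      (∏ x, (1 + φ x)) := by
  have hf : ∀ j : ℕ, (j.factorial : ℂ) ≠ 0 := fun j => by exact_mod_cast j.factorial_ne_zero
  simp only [sum_embedding_prod, inv_mul_cancel_left₀ (hf _)]
  rw [Finset.prod_one_add, Finset.sum_powerset]
  refine hasSum_sum_of_ne_finset_zero fun k hk => ?_
  rw [Finset.powersetCard_eq_empty.2 (by simpa using hk), Finset.sum_empty]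

/-! ### Sums over the points of a process -/

namespace PointProcess

variable {Ω : Type*} [MeasurableSpace Ω] (X : PointProcess Ω)

/-- The finite set of points of the process in a compact set. -/
def pointsIn {K : Set ℂ} (hK : IsCompact K) (ω : Ω) : Finset ℂ := (X.locallyFinite ω K hK).toFinset

theorem mem_pointsIn {K : Set ℂ} (hK : IsCompact K) {ω : Ω} {x : ℂ} :
    x ∈ X.pointsIn hK ω ↔ x ∈ X.points ω ∧ x ∈ K := by
  simp [pointsIn]

theorem tsum_points_eq_sum {R : Type*} [AddCommMonoid R] [TopologicalSpace R] {K : Set ℂ}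
    (hK : IsCompact K) {φ : ℂ → R} (hφ : ∀ z, z ∉ K → φ z = 0) (ω : Ω) :
    ∑' x : X.points ω, φ x = ∑ x : X.pointsIn hK ω, φ x := by
  rw [tsum_subtype, tsum_eq_sum (s := X.pointsIn hK ω), Finset.univ_eq_attach,
    Finset.sum_attach _ φ]
  · refine Finset.sum_congr rfl fun x hx => ?_
    rw [Set.indicator_of_mem ((X.mem_pointsIn hK).1 hx).1]
  · intro x hx
    rw [X.mem_pointsIn, not_and] at hx
    by_cases hx' : x ∈ X.points ω
    · rw [Set.indicator_of_mem hx', hφ x (hx hx')]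
    · rw [Set.indicator_of_notMem hx']

/-- Inclusion of the injective tuples of points in a compact set. -/
def embeddingIn {K : Set ℂ} (hK : IsCompact K) (ω : Ω) (k : ℕ) (p : Fin k ↪ X.pointsIn hK ω) :
    Fin k ↪ X.points ω :=
  ⟨fun i => ⟨p i, ((X.mem_pointsIn hK).1 (p i).2).1⟩, fun i j h => by
    have : (p i : ℂ) = p j := congrArg (fun a : X.points ω => (a : ℂ)) h
    exact p.injective (Subtype.ext this)⟩

theorem embeddingIn_injective {K : Set ℂ} (hK : IsCompact K) (ω : Ω) (k : ℕ) :
    Function.Injective (X.embeddingIn hK ω k) := by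
  intro p q h
  ext i
  have := DFunLike.congr_fun h i
  exact congrArg (fun a : X.points ω => (a : ℂ)) this

theorem support_subset_range_embeddingIn {R : Type*} [Zero R] {K : Set ℂ} (hK : IsCompact K)
    {k : ℕ} {F : (Fin k → ℂ) → R} (hF : ∀ x, (∃ i, x i ∉ K) → F x = 0) (ω : Ω) :
    Function.support (fun p : Fin k ↪ X.points ω => F fun i => p i) ⊆
      Set.range (X.embeddingIn hK ω k) := by
  intro p hp
  have hmem : ∀ i, (p i : ℂ) ∈ K := by
    by_contra! hcon
    exact hp (hF _ hcon)
  refine ⟨⟨fun i => ⟨p i, (X.mem_pointsIn hK).2 ⟨(p i).2, hmem i⟩⟩, fun i j h => ?_⟩, ?_⟩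
  · exact p.injective (Subtype.ext (congrArg (fun a : X.pointsIn hK ω => (a : ℂ)) h))
  · ext i
    rfl

theorem tsum_embedding_eq_sum {R : Type*} [AddCommMonoid R] [TopologicalSpace R] {K : Set ℂ}
    (hK : IsCompact K) {k : ℕ} {F : (Fin k → ℂ) → R} (hF : ∀ x, (∃ i, x i ∉ K) → F x = 0) (ω : Ω) :
    ∑' p : Fin k ↪ X.points ω, F (fun i => p i) =
      ∑ p : Fin k ↪ X.pointsIn hK ω, F (fun i => p i) := by
  rw [← (X.embeddingIn_injective hK ω k).tsum_eq (X.support_subset_range_embeddingIn hK hF ω),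
    tsum_fintype]
  rfl

theorem summable_embedding {K : Set ℂ} (hK : IsCompact K) {k : ℕ} {F : (Fin k → ℂ) → ℝ}
    (hF : ∀ x, (∃ i, x i ∉ K) → F x = 0) (ω : Ω) :
    Summable fun p : Fin k ↪ X.points ω => F (fun i => p i) :=
  summable_of_hasFiniteSupport
    ((Set.finite_range _).subset (X.support_subset_range_embeddingIn hK hF ω))

/-- A simple function has a linear statistic that depends only on finitely many counts. -/
theorem measurable_tsum_points {K : Set ℂ} (hK : IsCompact K) {φ : ℂ → ℂ} (hφm : Measurable φ)
    (hφ : ∀ z, z ∉ K → φ z = 0) : Measurable fun ω => ∑' x : X.points ω, φ x := by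
  have hcount : ∀ B : Set ℂ, MeasurableSet B →
      Measurable fun ω => ((X.points ω ∩ B).ncard : ℂ) := fun B hB => by
    have h1 : Measurable fun n : ℕ∞ => ((n.toNat : ℕ) : ℂ) := measurable_of_countable _
    exact h1.comp (X.measurable_count B hB)
  have hsm : StronglyMeasurable φ := hφm.stronglyMeasurable
  have happrox : ∀ n ω, ∑ x : X.pointsIn hK ω, hsm.approx n x =
      ∑ c ∈ (hsm.approx n).range, ((X.points ω ∩ (K ∩ hsm.approx n ⁻¹' {c})).ncard : ℂ) * c := by
    intro n ω
    rw [Finset.univ_eq_attach, Finset.sum_attach _ (fun x => hsm.approx n x),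
      ← Finset.sum_fiberwise_of_maps_to (t := (hsm.approx n).range)
        (g := hsm.approx n) (fun x _ => SimpleFunc.mem_range_self _ _)]
    refine Finset.sum_congr rfl fun c _ => ?_
    rw [Finset.sum_congr rfl (g := fun _ => c) fun x hx => (Finset.mem_filter.1 hx).2,
      Finset.sum_const, nsmul_eq_mul]
    congr 2
    rw [← Set.ncard_coe_finset]
    congr 1
    ext x
    rw [Finset.mem_coe, Finset.mem_filter, X.mem_pointsIn]
    exact and_assoc
  refine measurable_of_tendsto_metrizable
    (f := fun n ω => ∑ x : X.pointsIn hK ω, hsm.approx n x) (fun n => ?_) ?_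
  · simp only [happrox]
    refine Finset.measurable_sum _ fun c _ => Measurable.mul_const (hcount _ ?_) c
    exact hK.measurableSet.inter ((hsm.approx n).measurableSet_fiber c)
  · rw [tendsto_pi_nhds]
    intro ω
    rw [X.tsum_points_eq_sum hK hφ]
    exact tendsto_finsetSum _ fun x _ => hsm.tendsto_approx x

/-- Newton's identities reduce the measurability of sums over injective tuples to that of linear
statistics. -/
theorem measurable_tsum_embedding {K : Set ℂ} (hK : IsCompact K) {φ : ℂ → ℂ} (hφm : Measurable φ)
    (hφ : ∀ z, z ∉ K → φ z = 0) (k : ℕ) :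
    Measurable fun ω => ∑' p : Fin k ↪ X.points ω, ∏ i, φ (p i) := by
  have hprod : ∀ (k : ℕ) (x : Fin k → ℂ), (∃ i, x i ∉ K) → ∏ i, φ (x i) = 0 :=
    fun k x ⟨i, hi⟩ => Finset.prod_eq_zero (Finset.mem_univ i) (hφ _ hi)
  have hsum : ∀ (k : ℕ) (ω : Ω), ∑' p : Fin k ↪ X.points ω, ∏ i, φ (p i) =
      ∑ p : Fin k ↪ X.pointsIn hK ω, ∏ i, φ (p i) := fun k ω =>
    X.tsum_embedding_eq_sum hK (F := fun x => ∏ i, φ (x i)) (hprod k) ω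
  induction k using Nat.strong_induction_on with
  | _ k ih =>
    rcases eq_or_ne k 0 with rfl | hk
    · rw [funext (hsum 0)]
      simp
    rw [funext (hsum k), funext fun ω =>
      sum_embedding_prod_newton (fun x : X.pointsIn hK ω => φ x) hk]
    refine (Finset.measurable_sum _ fun a ha => ?_).const_mul _ |>.const_mul _
    rw [Finset.mem_filter, Finset.HasAntidiagonal.mem_antidiagonal] at ha
    have iha := ih a.1 ha.2
    rw [funext (hsum a.1)] at iha
    refine ((iha.const_mul _).const_mul _).mul ?_
    have ha2 : a.2 ≠ 0 := by omega
    have hpow : ∀ z, z ∉ K → φ z ^ a.2 = 0 := fun z hz => by rw [hφ z hz, zero_pow ha2]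
    have h := X.measurable_tsum_points hK (hφm.pow_const a.2) hpow
    simpa only [X.tsum_points_eq_sum hK hpow] using h

theorem measurable_linearStatistic {K : Set ℂ} (hK : IsCompact K) {f : ℂ → ℝ} (hfm : Measurable f)
    (hf : ∀ z, z ∉ K → f z = 0) : Measurable (X.linearStatistic f) := by
  have h := X.measurable_tsum_points hK (Complex.measurable_ofReal.comp hfm)
    (fun z hz => by simp [hf z hz])
  have h2 : X.linearStatistic f = fun ω => (∑' x : X.points ω, ((f x : ℝ) : ℂ)).re := by
    ext ω
    rw [← Complex.ofReal_tsum, Complex.ofReal_re, linearStatistic]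
  rw [h2]
  exact Complex.measurable_re.comp h

theorem measurable_linearStatistic_const (c : ℝ) : Measurable (X.linearStatistic fun _ => c) := by
  have h : X.linearStatistic (fun _ => c) =
      fun ω => (((X.points ω ∩ Set.univ).encard.toNat : ℕ) : ℝ) * c := by
    ext ω
    rw [linearStatistic, tsum_const, nsmul_eq_mul, Set.inter_univ]
    rfl
  rw [h]
  have h1 : Measurable fun n : ℕ∞ => ((n.toNat : ℕ) : ℝ) := measurable_of_countable _
  exact (h1.comp (X.measurable_count _ MeasurableSet.univ)).mul_const c

end PointProcess

/-! ### Kernels of Gram type -/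

instance : Measure.IsAddHaarMeasure gam :=
  Measure.IsAddHaarMeasure.smul volume (by simp [Real.pi_pos]) ENNReal.ofReal_ne_top

open scoped ComplexOrder in
/-- A weak form of Hadamard's inequality: by the inequality of arithmetic and geometric means for the
eigenvalues, `det A ≤ (tr A / k)ᵏ`. -/
theorem _root_.Matrix.PosSemidef.det_re_le_pow {k : ℕ} {A : Matrix (Fin k) (Fin k) ℂ}
    (hA : A.PosSemidef) {B : ℝ} (hB : ∀ i, (A i i).re ≤ B) : A.det.re ≤ B ^ k := by
  rcases Nat.eq_zero_or_pos k with rfl | hk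
  · simp
  have hk' : (0 : ℝ) < k := by exact_mod_cast hk
  have hev := hA.eigenvalues_nonneg
  have hdet : A.det.re = ∏ i, hA.1.eigenvalues i := by
    rw [hA.1.det_eq_prod_eigenvalues]
    simp only [Complex.coe_algebraMap, ← Complex.ofReal_prod,
      Complex.ofReal_re]
  have htr : ∑ i, hA.1.eigenvalues i = ∑ i, (A i i).re := by
    have := congrArg Complex.re hA.1.trace_eq_sum_eigenvalues
    rw [Matrix.trace, Complex.re_sum, Complex.re_sum] at this
    exact this.symm
  have ham := Real.geom_mean_le_arith_mean Finset.univ (fun _ => (1 : ℝ)) hA.1.eigenvalues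
    (fun _ _ => zero_le_one) (by simpa using hk') (fun i _ => hev i)
  simp only [Real.rpow_one, Finset.sum_const, Finset.card_univ, Fintype.card_fin, nsmul_eq_mul,
    mul_one, one_mul] at ham
  have hprod : 0 ≤ ∏ i, hA.1.eigenvalues i := Finset.prod_nonneg fun i _ => hev i
  have h1 : (∏ i, hA.1.eigenvalues i) ^ (k : ℝ)⁻¹ ≤ B := by
    refine ham.trans ?_
    rw [htr, div_le_iff₀ hk', mul_comm]
    calc ∑ i, (A i i).re ≤ ∑ _i : Fin k, B := Finset.sum_le_sum fun i _ => hB i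
      _ = k * B := by simp
  have h2 := pow_le_pow_left₀ (Real.rpow_nonneg hprod _) h1 k
  rwa [Real.rpow_inv_natCast_pow hprod hk.ne', ← hdet] at h2

/-- A kernel `K x y = ⟨w x, w y⟩` given by a continuous family of vectors `w` of squared norm
at most `B`. -/
def IsGramKernel (K : ℂ → ℂ → ℂ) (B : ℝ) : Prop :=
  ∃ w : ℂ → L2, Continuous w ∧ (∀ x y, K x y = inner ℂ (w x) (w y)) ∧ ∀ x, ‖w x‖ ^ 2 ≤ B

/-- The correlation function `det [K(xᵢ, xⱼ)]`. -/
def corr (K : ℂ → ℂ → ℂ) {k : ℕ} (x : Fin k → ℂ) : ℝ :=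
  (Matrix.det (Matrix.of fun i j => K (x i) (x j))).re

section

open scoped ComplexOrder

namespace IsGramKernel

variable {K : ℂ → ℂ → ℂ} {B : ℝ} (hK : IsGramKernel K B)
include hK

theorem posSemidef {k : ℕ} (x : Fin k → ℂ) :
    (Matrix.of fun i j => K (x i) (x j)).PosSemidef := by
  obtain ⟨w, -, hw, -⟩ := hK
  have h : (Matrix.of fun i j => K (x i) (x j)) = Matrix.gram ℂ (fun i => w (x i)) := by
    ext i j
    simp [Matrix.gram_apply, hw]
  rw [h]
  exact Matrix.posSemidef_gram ℂ _

theorem corr_nonneg {k : ℕ} (x : Fin k → ℂ) : 0 ≤ corr K x :=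
  (Complex.le_def.1 (hK.posSemidef x).det_nonneg).1

theorem corr_le {k : ℕ} (x : Fin k → ℂ) : corr K x ≤ B ^ k := by
  refine (hK.posSemidef x).det_re_le_pow fun i => ?_
  obtain ⟨w, -, hw, hB⟩ := hK
  rw [Matrix.of_apply, hw]
  exact (inner_self_eq_norm_sq (𝕜 := ℂ) (w (x i))).le.trans (hB _)

theorem continuous_corr {k : ℕ} : Continuous (corr K : (Fin k → ℂ) → ℝ) := by
  obtain ⟨w, hwc, hw, -⟩ := hK
  refine Complex.continuous_re.comp (Continuous.matrix_det ?_)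
  refine continuous_matrix fun i j => ?_
  simp only [Matrix.of_apply, hw]
  exact (hwc.comp (continuous_apply i)).inner (hwc.comp (continuous_apply j))

end IsGramKernel

end

theorem isGramKernel_ginibreKernel_one : IsGramKernel (ginibreKernel 1) 1 :=
  ⟨reproducing 1, continuous_reproducing one_pos,
    fun x y => (inner_reproducing_reproducing one_pos x y).symm,
    fun x => (norm_sq_reproducing one_pos x).le⟩

theorem norm_spectralProjection_le (N : ℝ) (V : ℂ → ℝ) (μ : ℝ) (u : L2) :
    ‖spectralProjection N V μ u‖ ≤ ‖u‖ := by
  simpa using (spectralProjection N V μ).le_of_opNorm_le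
    (spectralSubspace N V μ).starProjection_norm_le u

theorem isGramKernel_spectralKernel {N : ℝ} (hN : 0 < N) (V : ℂ → ℝ) (μ : ℝ) :
    IsGramKernel (spectralKernel N V μ) N := by
  refine ⟨fun x => spectralProjection N V μ (reproducing N x),
    (spectralProjection N V μ).continuous.comp (continuous_reproducing hN),
    spectralKernel_eq_inner N V μ, fun x => ?_⟩
  have h := pow_le_pow_left₀ (norm_nonneg _)
    (norm_spectralProjection_le N V μ (reproducing N x)) 2
  rwa [norm_sq_reproducing hN x] at h

theorem IsGramKernel.rescale {K : ℂ → ℂ → ℂ} {N : ℝ} (hN : 0 < N) (hK : IsGramKernel K N)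
    (x ε : ℂ) : IsGramKernel (fun u v => (N : ℂ)⁻¹ * K (x + ε * u) (x + ε * v)) 1 := by
  obtain ⟨w, hwc, hw, hB⟩ := hK
  have hs := Real.mul_self_sqrt hN.le
  refine ⟨fun u => ((√N : ℂ))⁻¹ • w (x + ε * u), ?_, fun u v => ?_, fun u => ?_⟩
  · have : Continuous fun u : ℂ => x + ε * u := by fun_prop
    exact (hwc.comp this).const_smul (c := ((√N : ℂ))⁻¹)
  · simp only
    rw [hw, inner_smul_left, inner_smul_right, map_inv₀, Complex.conj_ofReal, ← mul_assoc,
      ← mul_inv, ← Complex.ofReal_mul, hs]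
  · rw [norm_smul, mul_pow, norm_inv, Complex.norm_real, Real.norm_eq_abs, inv_pow, sq_abs,
      Real.sq_sqrt hN.le, inv_mul_le_iff₀ hN, mul_one]
    exact hB _

/-! ### Expectations of products over tuples of points -/

section Determinantal

variable {Ω : Type*} [MeasurableSpace Ω] {P : Measure Ω} {X : PointProcess Ω} {K : ℂ → ℂ → ℂ}
  {B : ℝ}

theorem PointProcess.measurable_tsum_embedding_norm (X : PointProcess Ω) {C : Set ℂ}
    (hC : IsCompact C) {φ : ℂ → ℂ} (hφm : Measurable φ) (hφ : ∀ z, z ∉ C → φ z = 0) (k : ℕ) :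
    Measurable fun ω => ∑' p : Fin k ↪ X.points ω, ∏ i, ‖φ (p i)‖ := by
  have h := Complex.measurable_re.comp (X.measurable_tsum_embedding hC
    (φ := fun z => ((‖φ z‖ : ℝ) : ℂ)) (by fun_prop) (fun z hz => by simp [hφ z hz]) k)
  refine Eq.mp (congrArg _ ?_) h
  ext ω
  simp only [Function.comp_apply, ← Complex.ofReal_prod, ← Complex.ofReal_tsum, Complex.ofReal_re]

theorem integrable_prod_mul_corr (hK : IsGramKernel K B) {φ : ℂ → ℂ} (hφc : Continuous φ)
    (hφs : HasCompactSupport φ) (k : ℕ) :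
    Integrable (fun x : Fin k → ℂ => (∏ i, φ (x i)) * (corr K x : ℂ))
      (Measure.pi fun _ => gam) := by
  have h1 : Integrable (fun x : Fin k → ℂ => ∏ i, φ (x i)) (Measure.pi fun _ => gam) :=
    Integrable.fintype_prod fun _ => hφc.integrable_of_hasCompactSupport hφs
  refine h1.mul_bdd (c := B ^ k)
    (Complex.continuous_ofReal.comp hK.continuous_corr).aestronglyMeasurable
    (Eventually.of_forall fun x => ?_)
  rw [Complex.norm_real, Real.norm_eq_abs, abs_of_nonneg (hK.corr_nonneg x)]
  exact hK.corr_le x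

theorem integral_prod_norm (φ : ℂ → ℂ) (k : ℕ) :
    ∫ x : Fin k → ℂ, ∏ i, ‖φ (x i)‖ ∂(Measure.pi fun _ => gam) = (∫ z, ‖φ z‖ ∂gam) ^ k := by
  rw [integral_fintype_prod_eq_prod (μ := fun _ : Fin k => gam) (fun _ z => ‖φ z‖)]
  simp

theorem IsDeterminantal.integral_tsum_nonneg (hX : IsDeterminantal P X K) (hK : IsGramKernel K B)
    {C : Set ℂ} (hC : IsCompact C) {k : ℕ} {G : (Fin k → ℂ) → ℝ} (hGm : Measurable G)
    (hG0 : ∀ x, 0 ≤ G x) (hGC : ∀ x, (∃ i, x i ∉ C) → G x = 0)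
    (hint : Integrable (fun x => G x * corr K x) (Measure.pi fun _ => gam))
    (hmeas : Measurable fun ω => ∑' p : Fin k ↪ X.points ω, G fun i => p i) :
    Integrable (fun ω => ∑' p : Fin k ↪ X.points ω, G fun i => p i) P ∧
      ∫ ω, ∑' p : Fin k ↪ X.points ω, G (fun i => p i) ∂P =
        ∫ x, G x * corr K x ∂(Measure.pi fun _ => gam) := by
  have hnn : ∀ ω, 0 ≤ ∑' p : Fin k ↪ X.points ω, G fun i => p i :=
    fun ω => tsum_nonneg fun p => hG0 _
  have h1 : ∫⁻ ω, ENNReal.ofReal (∑' p : Fin k ↪ X.points ω, G fun i => p i) ∂P =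
      ∫⁻ x, ENNReal.ofReal (G x * corr K x) ∂(Measure.pi fun _ => gam) := by
    have h2 := hX k (fun x => ENNReal.ofReal (G x)) hGm.ennreal_ofReal
    simp only [ENNReal.ofReal_mul (hG0 _)]
    refine Eq.trans (lintegral_congr fun ω => ?_) h2
    exact ENNReal.ofReal_tsum_of_nonneg (fun p => hG0 _) (X.summable_embedding hC hGC ω)
  have hpos : ∀ x, 0 ≤ G x * corr K x := fun x => mul_nonneg (hG0 x) (hK.corr_nonneg x)
  have h3 : ∫⁻ x, ENNReal.ofReal (G x * corr K x) ∂(Measure.pi fun _ => gam) =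
      ENNReal.ofReal (∫ x, G x * corr K x ∂(Measure.pi fun _ => gam)) :=
    (ofReal_integral_eq_lintegral_ofReal hint (Eventually.of_forall hpos)).symm
  refine ⟨⟨hmeas.aestronglyMeasurable, ?_⟩, ?_⟩
  · rw [hasFiniteIntegral_iff_ofReal (Eventually.of_forall hnn), h1, h3]
    exact ENNReal.ofReal_lt_top
  · rw [integral_eq_lintegral_of_nonneg_ae (Eventually.of_forall hnn) hmeas.aestronglyMeasurable,
      h1, h3, ENNReal.toReal_ofReal (integral_nonneg hpos)]

theorem tsum_embedding_add {C : Set ℂ} (hC : IsCompact C) {k : ℕ} {F G : (Fin k → ℂ) → ℝ}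
    (hF : ∀ x, (∃ i, x i ∉ C) → F x = 0) (hG : ∀ x, (∃ i, x i ∉ C) → G x = 0) (ω : Ω) :
    ∑' p : Fin k ↪ X.points ω, (F (fun i => p i) + G fun i => p i) =
      ∑' p : Fin k ↪ X.points ω, F (fun i => p i) + ∑' p : Fin k ↪ X.points ω, G fun i => p i :=
  (X.summable_embedding hC hF ω).tsum_add (X.summable_embedding hC hG ω)

theorem IsDeterminantal.integral_tsum_norm_prod (hX : IsDeterminantal P X K)
    (hK : IsGramKernel K B) {φ : ℂ → ℂ} (hφc : Continuous φ) (hφs : HasCompactSupport φ) (k : ℕ) :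
    Integrable (fun ω => ∑' p : Fin k ↪ X.points ω, ∏ i, ‖φ (p i)‖) P ∧
      ∫ ω, ∑' p : Fin k ↪ X.points ω, ∏ i, ‖φ (p i)‖ ∂P =
        ∫ x, (∏ i, ‖φ (x i)‖) * corr K x ∂(Measure.pi fun _ : Fin k => gam) := by
  have hvan : ∀ z, z ∉ tsupport φ → φ z = 0 := fun z hz => image_eq_zero_of_notMem_tsupport hz
  have hGC : ∀ x : Fin k → ℂ, (∃ i, x i ∉ tsupport φ) → ∏ i, ‖φ (x i)‖ = 0 := fun x ⟨i, hi⟩ =>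
    Finset.prod_eq_zero (Finset.mem_univ i) (by rw [hvan _ hi, norm_zero])
  refine hX.integral_tsum_nonneg (G := fun x => ∏ i, ‖φ (x i)‖) hK hφs
    (by have := hφc; fun_prop)
    (fun x => Finset.prod_nonneg fun i _ => norm_nonneg _) hGC ?_ ?_
  · have h := (integrable_prod_mul_corr hK hφc hφs k).norm
    refine h.congr (Eventually.of_forall fun x => ?_)
    simp only [norm_mul, norm_prod, Complex.norm_real, Real.norm_eq_abs,
      abs_of_nonneg (hK.corr_nonneg x)]
  · exact X.measurable_tsum_embedding_norm hφs hφc.measurable hvan k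

/-- The defining formula of a determinantal process, extended from nonnegative observables to complex
products. -/
theorem IsDeterminantal.integral_tsum_prod (hX : IsDeterminantal P X K)
    (hK : IsGramKernel K B) {φ : ℂ → ℂ} (hφc : Continuous φ) (hφs : HasCompactSupport φ) (k : ℕ) :
    Integrable (fun ω => ∑' p : Fin k ↪ X.points ω, ∏ i, φ (p i)) P ∧
      ∫ ω, ∑' p : Fin k ↪ X.points ω, ∏ i, φ (p i) ∂P =
        ∫ x, (∏ i, φ (x i)) * (corr K x : ℂ) ∂(Measure.pi fun _ : Fin k => gam) := by
  have hvan : ∀ z, z ∉ tsupport φ → φ z = 0 := fun z hz => image_eq_zero_of_notMem_tsupport hz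
  have hvanp : ∀ x : Fin k → ℂ, (∃ i, x i ∉ tsupport φ) → ∏ i, φ (x i) = 0 := fun x ⟨i, hi⟩ =>
    Finset.prod_eq_zero (Finset.mem_univ i) (hvan _ hi)
  have hvann : ∀ x : Fin k → ℂ, (∃ i, x i ∉ tsupport φ) → ∏ i, ‖φ (x i)‖ = 0 := fun x hx => by
    rw [← norm_prod, hvanp x hx, norm_zero]
  obtain ⟨hDi, hDe⟩ := hX.integral_tsum_norm_prod hK hφc hφs k
  have hmeas := X.measurable_tsum_embedding hφs hφc.measurable hvan k
  have hFint := integrable_prod_mul_corr hK hφc hφs k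
  have hDint : Integrable (fun x : Fin k → ℂ => (∏ i, ‖φ (x i)‖) * corr K x)
      (Measure.pi fun _ => gam) := by
    refine hFint.norm.congr (Eventually.of_forall fun x => ?_)
    simp only [norm_mul, norm_prod, Complex.norm_real, Real.norm_eq_abs,
      abs_of_nonneg (hK.corr_nonneg x)]
  have hDm : Measurable fun ω => ∑' p : Fin k ↪ X.points ω, ∏ i, ‖φ (p i)‖ := 
    X.measurable_tsum_embedding_norm hφs hφc.measurable hvan k
  -- adding `∏ ‖φ(xᵢ)‖` makes a real-linear part of `∏ φ(xᵢ)` nonnegative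
  have part : ∀ (T : ℂ →L[ℝ] ℝ), (∀ z, |T z| ≤ ‖z‖) →
      Integrable (fun ω => T (∑' p : Fin k ↪ X.points ω, ∏ i, φ (p i))) P ∧
      ∫ ω, T (∑' p : Fin k ↪ X.points ω, ∏ i, φ (p i)) ∂P =
        ∫ x, T ((∏ i, φ (x i)) * (corr K x : ℂ)) ∂(Measure.pi fun _ : Fin k => gam) := by
    intro T hT
    have hTx : ∀ x : Fin k → ℂ, T ((∏ i, φ (x i)) * (corr K x : ℂ)) =
        T (∏ i, φ (x i)) * corr K x := fun x => by
      rw [mul_comm, ← Complex.real_smul, map_smul, smul_eq_mul, mul_comm]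
    have hTF : ∀ x : Fin k → ℂ, (∃ i, x i ∉ tsupport φ) → T (∏ i, φ (x i)) = 0 := fun x hx => by
      rw [hvanp x hx, map_zero]
    have hTs : ∀ ω, T (∑' p : Fin k ↪ X.points ω, ∏ i, φ (p i)) =
        ∑' p : Fin k ↪ X.points ω, T (∏ i, φ (p i)) := fun ω =>
      T.map_tsum (summable_of_hasFiniteSupport ((Set.finite_range _).subset
        (X.support_subset_range_embeddingIn hφs hvanp ω)))
    have hadd : ∀ ω, ∑' p : Fin k ↪ X.points ω, (T (∏ i, φ (p i)) + ∏ i, ‖φ (p i)‖) =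
        T (∑' p : Fin k ↪ X.points ω, ∏ i, φ (p i)) +
          ∑' p : Fin k ↪ X.points ω, ∏ i, ‖φ (p i)‖ := fun ω => by
      rw [hTs]
      exact tsum_embedding_add hφs (F := fun x => T (∏ i, φ (x i)))
        (G := fun x => ∏ i, ‖φ (x i)‖) hTF hvann ω
    have hTint : Integrable (fun x : Fin k → ℂ => T (∏ i, φ (x i)) * corr K x)
        (Measure.pi fun _ => gam) :=
      (T.integrable_comp hFint).congr (Eventually.of_forall hTx)
    have hsum := hX.integral_tsum_nonneg (k := k)
      (G := fun x => T (∏ i, φ (x i)) + ∏ i, ‖φ (x i)‖) hK hφs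
      (by have := hφc; fun_prop)
      (fun x => by
        have := (abs_le.1 (hT (∏ i, φ (x i)))).1
        rw [norm_prod] at this
        linarith)
      (fun x hx => by rw [hTF x hx, hvann x hx, add_zero])
      ((hTint.add hDint).congr (Eventually.of_forall fun x => by
        simp only [Pi.add_apply, add_mul]))
      (by rw [funext hadd]; exact (T.continuous.measurable.comp hmeas).add hDm)
    rw [funext hadd] at hsum
    simp only [add_mul] at hsum
    obtain ⟨hs1, hs2⟩ := hsum
    have hTi : Integrable (fun ω => T (∑' p : Fin k ↪ X.points ω, ∏ i, φ (p i))) P := by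
      refine (hs1.sub hDi).congr (Eventually.of_forall fun ω => ?_)
      simp
    refine ⟨hTi, ?_⟩
    rw [integral_add hTi hDi, integral_add hTint hDint, hDe] at hs2
    simp only [hTx]
    exact add_right_cancel hs2
  obtain ⟨hre, hre'⟩ := part Complex.reCLM Complex.abs_re_le_norm
  obtain ⟨him, him'⟩ := part Complex.imCLM Complex.abs_im_le_norm
  have hZ : Integrable (fun ω => ∑' p : Fin k ↪ X.points ω, ∏ i, φ (p i)) P := by
    refine ⟨hmeas.aestronglyMeasurable, ?_⟩
    refine (hre.norm.add him.norm).hasFiniteIntegral.mono (Eventually.of_forall fun ω => ?_)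
    rw [Pi.add_apply, Real.norm_of_nonneg (by positivity)]
    exact Complex.norm_le_abs_re_add_abs_im _
  refine ⟨hZ, ?_⟩
  rw [Complex.reCLM.integral_comp_comm hZ, Complex.reCLM.integral_comp_comm hFint] at hre'
  rw [Complex.imCLM.integral_comp_comm hZ, Complex.imCLM.integral_comp_comm hFint] at him'
  exact Complex.ext hre' him'

/-- The Fredholm series `∑ₖ (1/k!) ∫ ∏ φ(xᵢ) det [K(xᵢ, xⱼ)]`. -/
def fredholmSeries (K : ℂ → ℂ → ℂ) (φ : ℂ → ℂ) : ℂ :=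
  ∑' k : ℕ, (k.factorial : ℂ)⁻¹ *
    ∫ x, (∏ i, φ (x i)) * (corr K x : ℂ) ∂(Measure.pi fun _ : Fin k => gam)

theorem integral_norm_prod_mul_corr_le (hK : IsGramKernel K B) {φ : ℂ → ℂ} (hφc : Continuous φ)
    (hφs : HasCompactSupport φ) (k : ℕ) :
    ∫ x, (∏ i, ‖φ (x i)‖) * corr K x ∂(Measure.pi fun _ : Fin k => gam) ≤
      (B * ∫ z, ‖φ z‖ ∂gam) ^ k := by
  have h1 : Integrable (fun x : Fin k → ℂ => ∏ i, ‖φ (x i)‖) (Measure.pi fun _ => gam) :=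
    Integrable.fintype_prod fun _ => (hφc.integrable_of_hasCompactSupport hφs).norm
  rw [mul_pow, ← integral_prod_norm, ← integral_const_mul]
  refine integral_mono_of_nonneg (Eventually.of_forall fun x => ?_) (h1.const_mul _)
    (Eventually.of_forall fun x => ?_)
  · exact mul_nonneg (Finset.prod_nonneg fun i _ => norm_nonneg _) (hK.corr_nonneg x)
  · simp only
    rw [mul_comm]
    exact mul_le_mul_of_nonneg_right (hK.corr_le x) (Finset.prod_nonneg fun i _ => norm_nonneg _)

/-- The expectation of a multiplicative statistic is a Fredholm series; the interchange of sum and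
expectation is justified by the bound `det [K(xᵢ, xⱼ)] ≤ Bᵏ`. -/
theorem IsDeterminantal.integral_prod_one_add [IsProbabilityMeasure P]
    (hX : IsDeterminantal P X K) (hK : IsGramKernel K B) {φ : ℂ → ℂ} (hφc : Continuous φ)
    {C : Set ℂ} (hC : IsCompact C) (hvan : ∀ z, z ∉ C → φ z = 0) :
    ∫ ω, ∏ x : X.pointsIn hC ω, (1 + φ x) ∂P = fredholmSeries K φ := by
  have hφs : HasCompactSupport φ := HasCompactSupport.intro hC hvan
  have hvanp : ∀ (k : ℕ) (x : Fin k → ℂ), (∃ i, x i ∉ C) → ∏ i, φ (x i) = 0 :=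
    fun k x ⟨i, hi⟩ => Finset.prod_eq_zero (Finset.mem_univ i) (hvan _ hi)
  have hZ : ∀ (k : ℕ) (ω : Ω), ∑' p : Fin k ↪ X.points ω, ∏ i, φ (p i) =
      ∑ p : Fin k ↪ X.pointsIn hC ω, ∏ i, φ (p i) := fun k ω =>
    X.tsum_embedding_eq_sum hC (F := fun x => ∏ i, φ (x i)) (hvanp k) ω
  have hD : ∀ (k : ℕ) (ω : Ω), ∑' p : Fin k ↪ X.points ω, ∏ i, ‖φ (p i)‖ =
      ∑ p : Fin k ↪ X.pointsIn hC ω, ∏ i, ‖φ (p i)‖ := fun k ω =>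
    X.tsum_embedding_eq_sum hC (F := fun x => ∏ i, ‖φ (x i)‖)
      (fun x hx => by rw [← norm_prod, hvanp k x hx, norm_zero]) ω
  set Z : ℕ → Ω → ℂ := fun k ω =>
    (k.factorial : ℂ)⁻¹ * ∑' p : Fin k ↪ X.points ω, ∏ i, φ (p i) with hZdef
  have hZi : ∀ k, Integrable (Z k) P := fun k =>
    (hX.integral_tsum_prod hK hφc hφs k).1.const_mul _
  have hnorm : ∀ k, ∫ ω, ‖Z k ω‖ ∂P ≤ (B * ∫ z, ‖φ z‖ ∂gam) ^ k / k.factorial := by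
    intro k
    obtain ⟨h1, h2⟩ := hX.integral_tsum_norm_prod hK hφc hφs k
    have h3 : ∫ ω, ‖Z k ω‖ ∂P ≤
        ∫ ω, (k.factorial : ℝ)⁻¹ * ∑' p : Fin k ↪ X.points ω, ∏ i, ‖φ (p i)‖ ∂P := by
      refine integral_mono (hZi k).norm (h1.const_mul _) fun ω => ?_
      simp only [hZdef, norm_mul, norm_inv, Complex.norm_natCast]
      refine mul_le_mul_of_nonneg_left ?_ (by positivity)
      rw [hZ, hD]
      refine (norm_sum_le _ _).trans (le_of_eq ?_)
      simp only [norm_prod]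
    rw [integral_const_mul, h2] at h3
    rw [div_eq_inv_mul]
    exact h3.trans (mul_le_mul_of_nonneg_left (integral_norm_prod_mul_corr_le hK hφc hφs k)
      (by positivity))
  have hsummable : Summable fun k => ∫ ω, ‖Z k ω‖ ∂P :=
    Summable.of_nonneg_of_le (fun k => integral_nonneg fun ω => norm_nonneg _) hnorm
      (Real.summable_pow_div_factorial _)
  have hmain := integral_tsum_of_summable_integral_norm hZi hsummable
  have hpt : ∀ ω, ∑' k, Z k ω = ∏ x : X.pointsIn hC ω, (1 + φ x) := fun ω => by
    simp only [hZdef, hZ]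
    exact (prod_one_add_eq_tsum fun x : X.pointsIn hC ω => φ x).tsum_eq
  simp only [hpt] at hmain
  rw [← hmain, fredholmSeries]
  refine tsum_congr fun k => ?_
  simp only [hZdef]
  rw [integral_const_mul, (hX.integral_tsum_prod hK hφc hφs k).2]

/-- The function `e^{itf} - 1` entering the characteristic function of a linear statistic. -/
def expSubOne (f : ℂ → ℝ) (t : ℝ) (z : ℂ) : ℂ := Complex.exp (t * f z * Complex.I) - 1

theorem continuous_expSubOne {f : ℂ → ℝ} (hf : Continuous f) (t : ℝ) :
    Continuous (expSubOne f t) := by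
  unfold expSubOne
  fun_prop

theorem hasCompactSupport_expSubOne {f : ℂ → ℝ} (hf : HasCompactSupport f) (t : ℝ) :
    HasCompactSupport (expSubOne f t) := by
  refine hf.mono fun z hz => ?_
  contrapose! hz
  rw [Function.notMem_support] at hz ⊢
  simp [expSubOne, hz]

theorem IsDeterminantal.charFun_linearStatistic [IsProbabilityMeasure P]
    (hX : IsDeterminantal P X K) (hK : IsGramKernel K B) {f : ℂ → ℝ} (hfc : Continuous f)
    (hfs : HasCompactSupport f) (t : ℝ) :
    charFun (P.map (X.linearStatistic f)) t = fredholmSeries K (expSubOne f t) := by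
  have hvan : ∀ z, z ∉ tsupport f → f z = 0 := fun z hz => image_eq_zero_of_notMem_tsupport hz
  have hm := X.measurable_linearStatistic hfs hfc.measurable hvan
  rw [charFun_apply_real, integral_map hm.aemeasurable (by fun_prop),
    ← hX.integral_prod_one_add hK (continuous_expSubOne hfc t) hfs
      (fun z hz => by simp [expSubOne, hvan z hz])]
  refine integral_congr_ae (Eventually.of_forall fun ω => ?_)
  simp only [expSubOne, add_sub_cancel]
  rw [← Complex.exp_sum, PointProcess.linearStatistic, X.tsum_points_eq_sum hfs hvan]
  push_cast
  rw [Finset.mul_sum, Finset.sum_mul]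

end Determinantal

/-! ### Rescaling and convergence of Fredholm series -/

theorem corr_const_mul (K : ℂ → ℂ → ℂ) (N : ℝ) (x ε : ℂ) {k : ℕ} (u : Fin k → ℂ) :
    corr (fun u v => (N : ℂ)⁻¹ * K (x + ε * u) (x + ε * v)) u =
      (N⁻¹) ^ k * corr K fun i => x + ε * u i := by
  have h : (Matrix.of fun i j => (N : ℂ)⁻¹ * K (x + ε * u i) (x + ε * u j)) =
      (N : ℂ)⁻¹ • Matrix.of fun i j => K (x + ε * u i) (x + ε * u j) := by
    ext i j
    simp
  rw [corr, corr, h, Matrix.det_smul, Fintype.card_fin, ← Complex.ofReal_inv, ← Complex.ofReal_pow,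
    Complex.re_ofReal_mul]

/-- Zooming in at `x` by the factor `√N` turns the kernel `K` into `N⁻¹ K(x + N^{-1/2} ·, x + N^{-1/2} ·)`,
the factor `N⁻¹` per point being the Jacobian. -/
theorem fredholmSeries_rescale {N : ℝ} (hN : 0 < N) (K : ℂ → ℂ → ℂ) (φ : ℂ → ℂ) (x : ℂ) :
    fredholmSeries K (fun z => φ ((z - x) / (microscale N : ℂ))) =
      fredholmSeries (fun u v => (N : ℂ)⁻¹ * K (x + microscale N * u) (x + microscale N * v)) φ := by
  refine tsum_congr fun k => ?_
  congr 1
  have hε := microscale_pos hN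
  have hε' : (microscale N : ℂ) ≠ 0 := by exact_mod_cast hε.ne'
  set H : (Fin k → ℂ) → ℂ := fun y =>
    (∏ i, φ ((y i - x) / (microscale N : ℂ))) * (corr K y : ℂ) with hH
  have h1 := integral_add_right_eq_self (μ := Measure.pi fun _ : Fin k => gam) H fun _ => x
  have h2 := Measure.integral_comp_smul (Measure.pi fun _ : Fin k => gam)
    (fun y => H (y + fun _ => x)) (microscale N)
  have h3 : ∀ u : Fin k → ℂ, H ((microscale N • u) + fun _ => x) =
      (∏ i, φ (u i)) * (corr K (fun i => x + microscale N * u i) : ℂ) := fun u => by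
    have h4 : ∀ i, (microscale N • u + fun _ => x : Fin k → ℂ) i = x + microscale N * u i := fun i => by
      rw [Pi.add_apply, Pi.smul_apply, Complex.real_smul, add_comm]
    simp only [hH]
    rw [show (microscale N • u + fun _ => x : Fin k → ℂ) =
      fun i => x + microscale N * u i from funext h4]
    congr 1
    refine Finset.prod_congr rfl fun i _ => ?_
    rw [add_sub_cancel_left, mul_div_cancel_left₀ _ hε']
  have hrank : Module.finrank ℝ (Fin k → ℂ) = 2 * k := by
    rw [Module.finrank_pi_fintype]
    simp [Complex.finrank_real_complex, mul_comm]
  simp only [h3] at h2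
  rw [h1, hrank, pow_mul, microscale_sq hN, abs_of_pos (by positivity), inv_pow, inv_inv] at h2
  simp only [corr_const_mul]
  push_cast
  simp only [mul_left_comm _ (((N : ℂ)⁻¹) ^ k)]
  rw [integral_const_mul, h2, Complex.real_smul]
  push_cast
  rw [← mul_assoc, ← mul_pow, inv_mul_cancel₀ (by exact_mod_cast hN.ne'), one_pow, one_mul]

theorem tendsto_fredholmSeries {ι : Type*} {l : Filter ι} [l.IsCountablyGenerated]
    {K : ι → ℂ → ℂ → ℂ} {K' : ℂ → ℂ → ℂ}
    (hK : ∀ᶠ n in l, IsGramKernel (K n) 1)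
    (hlim : ∀ (k : ℕ) (u : Fin k → ℂ), Tendsto (fun n => corr (K n) u) l (𝓝 (corr K' u)))
    {φ : ℂ → ℂ} (hφc : Continuous φ) (hφs : HasCompactSupport φ) :
    Tendsto (fun n => fredholmSeries (K n) φ) l (𝓝 (fredholmSeries K' φ)) := by
  have hint : ∀ k : ℕ, Integrable (fun x : Fin k → ℂ => ∏ i, ‖φ (x i)‖)
      (Measure.pi fun _ => gam) := fun k =>
    Integrable.fintype_prod fun _ => (hφc.integrable_of_hasCompactSupport hφs).norm
  refine tendsto_tsum_of_dominated_convergence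
    (bound := fun k => (1 * ∫ z, ‖φ z‖ ∂gam) ^ k / k.factorial)
    (Real.summable_pow_div_factorial _) (fun k => ?_) ?_
  · refine Tendsto.const_mul _ ?_
    refine tendsto_integral_filter_of_dominated_convergence (fun x => ∏ i, ‖φ (x i)‖) ?_ ?_
      (hint k) (Eventually.of_forall fun u => ?_)
    · filter_upwards [hK] with n hn
      exact (integrable_prod_mul_corr hn hφc hφs k).aestronglyMeasurable
    · filter_upwards [hK] with n hn
      refine Eventually.of_forall fun u => ?_
      rw [norm_mul, norm_prod, Complex.norm_real, Real.norm_eq_abs,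
        abs_of_nonneg (hn.corr_nonneg u)]
      refine mul_le_of_le_one_right (Finset.prod_nonneg fun i _ => norm_nonneg _) ?_
      simpa using hn.corr_le u
    · exact ((Complex.continuous_ofReal.tendsto _).comp (hlim k u)).const_mul _
  · filter_upwards [hK] with n hn k
    rw [norm_mul, norm_inv, Complex.norm_natCast, div_eq_inv_mul]
    refine mul_le_mul_of_nonneg_left ?_ (by positivity)
    refine (norm_integral_le_integral_norm _).trans (le_trans (le_of_eq ?_)
      (integral_norm_prod_mul_corr_le hn hφc hφs k))
    refine integral_congr_ae (Eventually.of_forall fun u => ?_)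
    simp only [norm_mul, norm_prod, Complex.norm_real, Real.norm_eq_abs,
      abs_of_nonneg (hn.corr_nonneg u)]

/-- Correlation functions do not see a change of gauge. -/
theorem corr_gauge (K : ℂ → ℂ → ℂ) {g : ℂ → ℂ} (hg : ∀ u, g u * conj (g u) = 1) {k : ℕ}
    (u : Fin k → ℂ) : corr (fun u v => conj (g u) * K u v * g v) u = corr K u := by
  have h : (Matrix.of fun i j => conj (g (u i)) * K (u i) (u j) * g (u j)) =
      Matrix.of fun i j => g (u j) *
        (Matrix.of fun i j => conj (g (u i)) * (Matrix.of fun i j => K (u i) (u j)) i j) i j := by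
    ext i j
    simp only [Matrix.of_apply]
    ring
  rw [corr, corr, h, Matrix.det_mul_row, Matrix.det_mul_column, ← mul_assoc,
    ← Finset.prod_mul_distrib]
  simp only [hg, Finset.prod_const_one, one_mul]

theorem tendsto_corr {ι : Type*} {l : Filter ι} {K : ι → ℂ → ℂ → ℂ} {K' : ℂ → ℂ → ℂ}
    (h : ∀ u v, Tendsto (fun n => K n u v) l (𝓝 (K' u v))) {k : ℕ} (u : Fin k → ℂ) :
    Tendsto (fun n => corr (K n) u) l (𝓝 (corr K' u)) := by
  have hm : Tendsto (fun n => (Matrix.of fun i j => K n (u i) (u j))) l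
      (𝓝 (Matrix.of fun i j => K' (u i) (u j))) :=
    tendsto_pi_nhds.2 fun i => tendsto_pi_nhds.2 fun j => h (u i) (u j)
  have hd : Continuous fun A : Matrix (Fin k) (Fin k) ℂ => A.det.re :=
    Complex.continuous_re.comp (Continuous.matrix_det continuous_id)
  exact (hd.tendsto _).comp hm

/-- The power `N ^ (-1/2)` of a nonpositive real has the value zero. -/
theorem microscale_eq_zero {N : ℝ} (hN : N ≤ 0) : microscale N = 0 := by
  rcases hN.eq_or_lt with rfl | h
  · exact Real.zero_rpow (by norm_num)
  · rw [microscale, Real.rpow_def_of_neg h, show (-(1 / 2) : ℝ) * Real.pi = -(Real.pi / 2) by ring,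
      Real.cos_neg, Real.cos_pi_div_two, mul_zero]

theorem hasCompactSupport_rescale {f : ℂ → ℝ} (hf : HasCompactSupport f) {ε : ℂ} (hε : ε ≠ 0)
    (x : ℂ) : HasCompactSupport fun z => f ((z - x) / ε) := by
  have h := hf.comp_homeomorph ((Homeomorph.subRight x).trans (Homeomorph.mulRight₀ ε⁻¹
    (inv_ne_zero hε)))
  simpa [Function.comp_def, div_eq_mul_inv] using h

theorem measurable_linearStatistic_rescale {Ω : Type*} [MeasurableSpace Ω] (X : PointProcess Ω)
    {f : ℂ → ℝ} (hfc : Continuous f) (hfs : HasCompactSupport f) (N : ℝ) (x : ℂ) :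
    Measurable (X.linearStatistic fun z => f ((z - x) / (microscale N : ℂ))) := by
  rcases le_or_gt N 0 with hN | hN
  · -- for `N ≤ 0` the scale is zero, and the test function is constant
    simp only [microscale_eq_zero hN, Complex.ofReal_zero, div_zero]
    exact X.measurable_linearStatistic_const _
  · have hε : (microscale N : ℂ) ≠ 0 := by exact_mod_cast (microscale_pos hN).ne'
    exact X.measurable_linearStatistic (hasCompactSupport_rescale hfs hε x)
      (by have := hfc; fun_prop) fun z hz =>
        image_eq_zero_of_notMem_tsupport (f := fun z => f ((z - x) / (microscale N : ℂ))) hz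

end BerezinToeplitz

end

open BerezinToeplitz in
theorem proposition2p11 :
    ∃ C : ℝ, 1 ≤ C ∧
      ∀ (V : ℂ → ℝ) (μ δ₀ : ℝ), PotentialAssumption V μ δ₀ →
      ∀ (δ : ℝ → ℝ) (x : ℝ → ℂ),
        AntitoneOn δ (Set.Ici 1) →
        (∀ᶠ N in atTop, C * microscale N * Real.log N ≤ δ N) →
        (∀ᶠ N in atTop, x N ∈ bulk V μ (δ N)) →
      ∀ {Ω : ℝ → Type*} [∀ N, MeasurableSpace (Ω N)] (P : ∀ N, Measure (Ω N))
        [∀ N, IsProbabilityMeasure (P N)] (X : ∀ N, PointProcess (Ω N)),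
        (∀ N, 1 ≤ N → IsDeterminantal (P N) (X N) (spectralKernel N V μ)) →
      ∀ {Ω' : Type*} [MeasurableSpace Ω'] (P' : Measure Ω') [IsProbabilityMeasure P']
        (Y : PointProcess Ω'),
        IsDeterminantal P' Y (ginibreKernel 1) →
      ∀ f : ℂ → ℝ, Continuous f → HasCompactSupport f →
        TendstoInDistribution
          (fun N => (X N).linearStatistic fun z => f ((z - x N) / (microscale N : ℂ)))
          atTop (Y.linearStatistic f) P P' := by
  refine ⟨1, le_rfl, ?_⟩
  intro V μ δ₀ hV δ x _ hδ hx Ω _ P _ X hX Ω' _ P' _ Y hY f hfc hfs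
  simp only [one_mul] at hδ
  refine ⟨fun N => (measurable_linearStatistic_rescale (X N) hfc hfs N (x N)).aemeasurable,
    (Y.measurable_linearStatistic hfs hfc.measurable
      fun z hz => image_eq_zero_of_notMem_tsupport hz).aemeasurable, ?_⟩
  refine tendsto_of_seq_tendsto fun s hs => ProbabilityMeasure.tendsto_iff_tendsto_charFun.2
    fun t => ?_
  suffices h : Tendsto (fun N => charFun ((P N).map
      ((X N).linearStatistic fun z => f ((z - x N) / (microscale N : ℂ)))) t) atTop
      (𝓝 (charFun (P'.map (Y.linearStatistic f)) t)) from h.comp hs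
  rw [hY.charFun_linearStatistic isGramKernel_ginibreKernel_one hfc hfs]
  have hfred := tendsto_fredholmSeries (l := atTop)
    (K := fun N : ℝ => fun u v => (N : ℂ)⁻¹ *
      spectralKernel N V μ (x N + microscale N * u) (x N + microscale N * v))
    (K' := ginibreKernel 1) ?_ ?_ (continuous_expSubOne hfc t) (hasCompactSupport_expSubOne hfs t)
  · refine hfred.congr' ?_
    filter_upwards [eventually_ge_atTop 1] with N hN
    have hN0 : 0 < N := one_pos.trans_le hN
    have hε : (microscale N : ℂ) ≠ 0 := by exact_mod_cast (microscale_pos hN0).ne'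
    rw [(hX N hN).charFun_linearStatistic (isGramKernel_spectralKernel hN0 V μ)
      (by fun_prop) (hasCompactSupport_rescale hfs hε (x N)),
      ← fredholmSeries_rescale hN0]
    rfl
  · filter_upwards [eventually_gt_atTop 0] with N hN
    exact (isGramKernel_spectralKernel hN V μ).rescale hN _ _
  · intro k u
    have h := tendsto_corr (hV.tendsto_gauged_spectralKernel hδ hx) u
    refine h.congr fun N => ?_
    exact corr_gauge (fun u v => (N : ℂ)⁻¹ *
      spectralKernel N V μ (x N + microscale N * u) (x N + microscale N * v))
      (gauge_mul_conj N (x N)) u
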